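/- **Definitions.** Let $n\ge 1$ and $f:\{0,1\}^n\to\{0,1\}$. A *quantum query algorithm* with query complexity $T$ consists of an integer $d\ge1$ and unitary operators $U_0,\dots,U_T$ on the Hilbert space with orthonormal basis $|i,b\rangle\otimes|w\rangle$ ($1\le i\le n$, $b\in\{0,1\}$, $1\le w\le d$). Its final state on input $x\in\{0,1\}^n$ is $U_TO_xU_{T-1}O_x\cdots U_1O_xU_0|\psi_0\rangle$, where $|\psi_0\rangle=|1,0\rangle\otimes|1\rangle$ is a fixed basis state and $O_x\,(|i,b\rangle\otimes|w\rangle)=|i,b\oplus x_i\rangle\otimes|w\rangle$; its output is obtained by measuring the register $b$ of the final state in the standard basis. It *computes* $f$ if, for every $x$, the output equals $f(x)$ with probability at least $2/3$. The *quantum query complexity* $Q(f)$ is the smallest $T$ such that some quantum query algorithm with query complexity $T$ computes $f$. The *adversary value* is $$\mathrm{adv}(f)=\sup_{\Gamma}\frac{\|\Gamma\|}{\max_{1\le i\le n}\|\Gamma_i\|},$$ over all non-zero real symmetric matrices $\Gamma$ indexed by $\{0,1\}^n$ with $\Gamma_{x,y}=0$ whenever $f(x)=f(y)$; here $\|\cdot\|$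 is the spectral norm, $(\Gamma_i)_{x,y}=0$ if $x_i=y_i$ and $(\Gamma_i)_{x,y}=\Gamma_{x,y}$ otherwise, and $\mathrm{adv}(f)=0$ if $f$ is constant. A *vector realization* for $f$ is a family of vectors $w^{(x,i)}\in\mathbb C^d$ ($x\in\{0,1\}^n$, $1\le i\le n$), for some integer $d \geq 0$, with $$\sum_{i:\,x_i\ne y_i}\langle w^{(x,i)},w^{(y,i)}\rangle=1\quad\text{for all }x,y\text{ with }f(x)\ne f(y),$$ and its *value* is $\max_{x}\sum_{i=1}^n\|w^{(x,i)}\|^2$. **Theorem.** 1. There is a universal constant $C>0$ such that for all $n\ge1$, all $f:\{0,1\}^n\to\{0,1\}$ and every vector realization $(w^{(x,i)})$ for $f$, there is a quantum query algorithm that computes $f$ with query complexity $$T\le C\max_{x}\sum_{i=1}^n\|w^{(x,i)}\|^2 .$$ 2. There are universal constants $0<a\le b$ such that every $f$ has a vector realization whose value $V$ satisfies $a\,\mathrm{adv}(f)\le V\le b\,\mathrm{adv}(f)$. 3. There are universal constants $0<c_1<c_2$ such that $Q(f)$ is well defined and $c_1\,\mathrm{adv}(f)\le Q(f)\le c_2\,\mathrm{adv}(f)$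 for every $f$. -/

import Mathlib

noncomputable section

namespace QuantumQuery

/-- Boolean inputs `x ∈ {0,1}ⁿ`, with `false` for `0` and `true` for `1`. -/
abbrev Input (n : ℕ) : Type := Fin n → Bool

/-! ### Quantum query algorithms -/

/-- The Hilbert space spanned by the orthonormal basis `|i, b⟩ ⊗ |w⟩`, with an index register `i`,
a value register `b` and an extra memory register `w` of dimension `d`. -/
abbrev QSpace (n d : ℕ) : Type := EuclideanSpace ℂ (Fin n × Bool × Fin d)

/-- The permutation `(i, b, w) ↦ (i, b ⊕ xᵢ, w)` of the computational basis. -/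
def oraclePerm {n : ℕ} (d : ℕ) (x : Input n) : Equiv.Perm (Fin n × Bool × Fin d) where
  toFun p := (p.1, xor p.2.1 (x p.1), p.2.2)
  invFun p := (p.1, xor p.2.1 (x p.1), p.2.2)
  left_inv p := by simp
  right_inv p := by simp

/-- The binary oracle `O_x ⊗ id`, i.e. the unitary with `|i, b⟩ ⊗ |w⟩ ↦ |i, b ⊕ xᵢ⟩ ⊗ |w⟩`. -/
def oracle {n : ℕ} (d : ℕ) (x : Input n) : QSpace n d ≃ₗᵢ[ℂ] QSpace n d :=
  LinearIsometryEquiv.piLpCongrLeft 2 ℂ ℂ (oraclePerm d x)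

theorem oracle_basis {n : ℕ} (d : ℕ) (x : Input n) (i : Fin n) (b : Bool) (w : Fin d) :
    oracle d x (EuclideanSpace.single (i, b, w) 1) =
      EuclideanSpace.single (i, xor b (x i), w) 1 := by
  simp [oracle, oraclePerm]

/-- A quantum query algorithm on `n`-bit inputs with query complexity `T`: a memory register of
some dimension `d ≥ 1` and a sequence `U₀, …, U_T` of (input independent) unitary operators. -/
structure Algorithm (n T : ℕ) where
  d : ℕ
  d_pos : 0 < d
  U : Fin (T + 1) → (QSpace n d ≃ₗᵢ[ℂ] QSpace n d)

namespace Algorithm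

variable {n T : ℕ} [NeZero n] (A : Algorithm n T)

/-- The initial basis state: all the registers are in their first basis state. -/
def initState : QSpace n A.d := EuclideanSpace.single (0, false, ⟨0, A.d_pos⟩) 1

/-- The intermediate state `U_t O_x U_{t-1} O_x ⋯ U₁ O_x U₀ |0, 0⟩ ⊗ |0⟩` after `t` queries. -/
def state (x : Input n) (t : Fin (T + 1)) : QSpace n A.d :=
  Fin.induction (motive := fun _ => QSpace n A.d) (A.U 0 A.initState)
    (fun s ψ => A.U s.succ (oracle A.d x ψ)) t

/-- The probability `‖(id ⊗ |b⟩⟨b| ⊗ id) ψ‖²` that measuring the value register of the final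
state `ψ` on input `x` returns `b`. -/
def outputProb (x : Input n) (b : Bool) : ℝ :=
  ∑ i : Fin n, ∑ w : Fin A.d, ‖A.state x (Fin.last T) (i, b, w)‖ ^ 2

/-- The algorithm computes `f` if it outputs `f x` with probability at least `2/3` on every
input `x`. -/
def Computes (f : Input n → Bool) : Prop :=
  ∀ x : Input n, 2 / 3 ≤ A.outputProb x (f x)

end Algorithm

/-- The quantum query complexity `Q(f)`: the smallest `T` such that some quantum algorithm with
query complexity `T` computes `f`. -/
def queryComplexity {n : ℕ} [NeZero n] (f : Input n → Bool) : ℕ :=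
  sInf {T : ℕ | ∃ A : Algorithm n T, A.Computes f}

/-! ### The adversary value -/

/-- The spectral norm of a real matrix. -/
def specNorm {n : ℕ} (M : Matrix (Input n) (Input n) ℝ) : ℝ :=
  ‖Matrix.toEuclideanCLM (n := Input n) (𝕜 := ℝ) M‖

/-- Adversary matrices for `f`: symmetric and `f`-sparse real matrices. -/
structure IsAdversaryMatrix {n : ℕ} (f : Input n → Bool)
    (Γ : Matrix (Input n) (Input n) ℝ) : Prop where
  symm : ∀ x y, Γ x y = Γ y x
  sparse : ∀ x y, f x = f y → Γ x y = 0

/-- The `i`-th punctured matrix `Γᵢ`. -/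
def punctured {n : ℕ} (Γ : Matrix (Input n) (Input n) ℝ) (i : Fin n) :
    Matrix (Input n) (Input n) ℝ :=
  Matrix.of fun x y => if x i = y i then 0 else Γ x y

/-- The maximum `maxᵢ ‖Γᵢ‖`. -/
def maxPuncturedNorm {n : ℕ} [NeZero n] (Γ : Matrix (Input n) (Input n) ℝ) : ℝ :=
  Finset.univ.sup' Finset.univ_nonempty (fun i : Fin n => specNorm (punctured Γ i))

/-- The ratios `‖Γ‖ / maxᵢ ‖Γᵢ‖`, over the non-zero adversary matrices `Γ` for `f`. -/
def adversaryRatios {n : ℕ} [NeZero n] (f : Input n → Bool) : Set ℝ :=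
  {r | ∃ Γ : Matrix (Input n) (Input n) ℝ,
    IsAdversaryMatrix f Γ ∧ Γ ≠ 0 ∧ r = specNorm Γ / maxPuncturedNorm Γ}

/-- The adversary value `adv(f)`. It is `0` if `f` is constant: there is then no non-zero
adversary matrix for `f`. -/
def adv {n : ℕ} [NeZero n] (f : Input n → Bool) : ℝ := sSup (adversaryRatios f)

theorem toEuclideanCLM_coord {n : ℕ} (M : Matrix (Input n) (Input n) ℝ)
    (v : EuclideanSpace ℝ (Input n)) (x : Input n) :
    (Matrix.toEuclideanCLM (n := Input n) (𝕜 := ℝ) M v) x = ∑ y, M x y * v y := by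
  have h := congrFun (Matrix.ofLp_toEuclideanCLM (n := Input n) (𝕜 := ℝ) M v) x
  rw [h]
  rfl

theorem abs_apply_le_specNorm {n : ℕ} (M : Matrix (Input n) (Input n) ℝ) (x y : Input n) :
    |M x y| ≤ specNorm M := by
  have h := (Matrix.toEuclideanCLM (n := Input n) (𝕜 := ℝ) M).le_opNorm
    (EuclideanSpace.single y 1)
  have h2 := PiLp.norm_apply_le
    (Matrix.toEuclideanCLM (n := Input n) (𝕜 := ℝ) M (EuclideanSpace.single y 1)) x
  rw [toEuclideanCLM_coord] at h2
  simp at h h2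
  exact h2.trans h

theorem specNorm_le_sum {n : ℕ} (M : Matrix (Input n) (Input n) ℝ) :
    specNorm M ≤ ∑ x, ∑ y, |M x y| := by
  refine ContinuousLinearMap.opNorm_le_bound _
    (Finset.sum_nonneg fun x _ => Finset.sum_nonneg fun y _ => abs_nonneg _) fun v => ?_
  have key : ∀ u : EuclideanSpace ℝ (Input n), ‖u‖ ≤ ∑ x, |u x| := by
    intro u
    rw [EuclideanSpace.norm_eq]
    refine Real.sqrt_le_iff.2 ⟨Finset.sum_nonneg fun x _ => abs_nonneg _, ?_⟩
    simp only [Real.norm_eq_abs]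
    exact Finset.sum_sq_le_sq_sum_of_nonneg fun x _ => abs_nonneg _
  refine (key _).trans ?_
  rw [Finset.sum_mul]
  refine Finset.sum_le_sum fun x _ => ?_
  rw [toEuclideanCLM_coord, Finset.sum_mul]
  refine (Finset.abs_sum_le_sum_abs _ _).trans (Finset.sum_le_sum fun y _ => ?_)
  rw [abs_mul]
  exact mul_le_mul_of_nonneg_left (PiLp.norm_apply_le v y) (abs_nonneg _)

/-- The supremum defining `adv f` is that of a bounded set. -/
theorem bddAbove_adversaryRatios {n : ℕ} [NeZero n] (f : Input n → Bool) :
    BddAbove (adversaryRatios f) := by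
  refine ⟨∑ _x : Input n, ∑ _y : Input n, 1, ?_⟩
  rintro r ⟨Γ, hΓ, -, rfl⟩
  have hle : ∀ i, specNorm (punctured Γ i) ≤ maxPuncturedNorm Γ := fun i =>
    Finset.le_sup' (fun i : Fin n => specNorm (punctured Γ i)) (Finset.mem_univ i)
  have hnn : 0 ≤ maxPuncturedNorm Γ := (norm_nonneg _).trans (hle 0)
  refine div_le_of_le_mul₀ hnn (by positivity) ((specNorm_le_sum Γ).trans ?_)
  simp only [Finset.sum_mul, one_mul]
  refine Finset.sum_le_sum fun x _ => Finset.sum_le_sum fun y _ => ?_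
  by_cases hxy : x = y
  · subst hxy
    rw [hΓ.sparse x x rfl, abs_zero]
    exact hnn
  · obtain ⟨i, hi⟩ := Function.ne_iff.1 hxy
    refine le_trans ?_ (hle i)
    have := abs_apply_le_specNorm (punctured Γ i) x y
    simpa [punctured, hi] using this

/-! ### Vector realizations of the dual program -/

/-- The dual feasibility condition `∑_{i : xᵢ ≠ yᵢ} ⟨w^(x,i), w^(y,i)⟩ = 1` whenever
`f x ≠ f y`. -/
def IsVectorRealization {n d : ℕ} (f : Input n → Bool)
    (w : Input n → Fin n → EuclideanSpace ℂ (Fin d)) : Prop :=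
  ∀ x y : Input n, f x ≠ f y →
    ∑ i ∈ Finset.univ.filter (fun i => x i ≠ y i), inner ℂ (w x i) (w y i) = 1

/-- The value `max_x ∑ᵢ ‖w^(x,i)‖²`. -/
def realizationValue {n d : ℕ} (w : Input n → Fin n → EuclideanSpace ℂ (Fin d)) : ℝ :=
  Finset.univ.sup' Finset.univ_nonempty (fun x : Input n => ∑ i : Fin n, ‖w x i‖ ^ 2)

end QuantumQuery

end

noncomputable section

namespace QuantumQuery

/-! ### Simulation of abstract query processes by query algorithms -/

/-! Realizations, algorithms and adversary matrices are linked by three implications.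

A realization of value `W` gives an algorithm with `O(W)` queries. Put `t_x = |0⟩ + α ∑ |i, x_i⟩
w^(x,i)` when `f x = 1` and `φ_y = |0⟩ - α⁻¹ ∑ |i, ¬y_i⟩ w^(y,i)` when `f y = 0`. The realization
condition says exactly that every `t_x` is orthogonal to every `φ_y`. Let `U_x` reflect about the
orthogonal complement of the span of the `φ_y` and then negate the vectors `|i, ¬x_i⟩`, which costs
one phase query. Then `U_x t_x = t_x` if `f x = 1`, and `U_x φ_x = φ_x - 2|0⟩` if `f x = 0`. Hence
the ergodic mean of the `U_x^k |0⟩` is large in the first case, by overlap with a short fixed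
vector, and small in the second, by telescoping. Its squared norm can be made an acceptance
probability (`exists_algorithm_average`), so neither phase estimation nor a spectral gap lemma is
needed.

An algorithm bounds the adversary value (`specNorm_le_of_computes`): the measure `∑ Γ_xy u_x v_y
Re⟨ψ_x, ψ_y⟩` changes little at each query (`query_progress`), yet is bounded away from `‖Γ‖` at the
end (`final_progress`).

The adversary value bounds the best realization, by semidefinite duality: if `V` is not attained,
Hahn–Banach separation produces an adversary matrix of ratio at least `V`
(`le_adv_of_not_mem_dualCone`). The converse bound of `adv` by the value of a realization comes from
composing the first two implications. -/

/-- Two isometric embeddings into the same finite-dimensional space differ by a unitary. -/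
theorem exists_unitary_apply_eq {H K : Type*} [NormedAddCommGroup H] [InnerProductSpace ℂ H]
    [NormedAddCommGroup K] [InnerProductSpace ℂ K] [FiniteDimensional ℂ K]
    (E F : H →ₗᵢ[ℂ] K) : ∃ V : K ≃ₗᵢ[ℂ] K, ∀ h, V (E h) = F h := by
  -- The map `F ∘ E⁻¹` is isometric on the range of `E`; finite dimension lets it extend to a
  -- unitary.
  let L : LinearMap.range E.toLinearMap →ₗᵢ[ℂ] K := F.comp E.equivRange.symm.toLinearIsometry
  refine ⟨L.extend.toLinearIsometryEquiv rfl, fun h => ?_⟩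
  have := L.extend_apply (E.equivRange h)
  simp only [LinearIsometry.coe_toLinearIsometryEquiv]
  simpa [L] using this

/-- Only the encodings around the oracle call matter: `A t` encodes the abstract state just before
query `t`, `B t` just after it. Since both are defined on all of `H` without reference to `x`, the
unitary leading from one to the other is input independent. -/
theorem exists_algorithm_of_process {n T d : ℕ} [NeZero n] (hd : 0 < d) {H : Type*}
    [NormedAddCommGroup H] [InnerProductSpace ℂ H]
    (A : Fin (T + 1) → H →ₗᵢ[ℂ] QSpace n d) (B : Fin T → H →ₗᵢ[ℂ] QSpace n d)
    (ψ : H) (hψ : ‖ψ‖ = 1) (s : Input n → Fin (T + 1) → H) (h0 : ∀ x, s x 0 = ψ)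
    (hs : ∀ x t, oracle d x (A t.castSucc (s x t.castSucc)) = B t (s x t.succ)) :
    ∃ alg : Algorithm n T, ∀ x b,
      alg.outputProb x b = ∑ i, ∑ w, ‖A (Fin.last T) (s x (Fin.last T)) (i, b, w)‖ ^ 2 := by
  have hinit : ‖(EuclideanSpace.single (0, false, ⟨0, hd⟩) 1 : QSpace n d)‖ = 1 := by simp
  have hA0 : ‖A 0 ψ‖ = 1 := by simpa using hψ
  -- Two unit vectors are two isometric embeddings of `ℂ`, so some unitary carries one to the other.
  obtain ⟨V0, hV0⟩ := exists_unitary_apply_eq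
    (LinearIsometry.toSpanSingleton ℂ (QSpace n d) hinit)
    (LinearIsometry.toSpanSingleton ℂ (QSpace n d) hA0)
  choose V hV using fun t : Fin T => exists_unitary_apply_eq (B t) (A t.succ)
  let alg : Algorithm n T := ⟨d, hd, Fin.cases V0 V⟩
  have hstate : ∀ x t, alg.state x t = A t (s x t) := by
    intro x t
    induction t using Fin.induction with
    | zero =>
      have := hV0 1
      simpa [alg, Algorithm.state, Algorithm.initState, h0] using this
    | succ t ih =>
      have h1 : alg.state x t.succ = V t (oracle d x (alg.state x t.castSucc)) := by
        simp [alg, Algorithm.state]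
      rw [h1, ih, hs, hV]
  exact ⟨alg, fun x b => by rw [Algorithm.outputProb, hstate]⟩

/-! ### Phase queries and block registers as isometries -/

/-- A linear isometry given by its coordinate functions. -/
def isometryOfCoord {ι κ : Type*} [Fintype ι] [Fintype κ] (f : EuclideanSpace ℂ ι → κ → ℂ)
    (hadd : ∀ g h p, f (g + h) p = f g p + f h p)
    (hsmul : ∀ (c : ℂ) h p, f (c • h) p = c * f h p)
    (hnorm : ∀ h, ∑ p, ‖f h p‖ ^ 2 = ∑ j, ‖h j‖ ^ 2) :
    EuclideanSpace ℂ ι →ₗᵢ[ℂ] EuclideanSpace ℂ κ where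
  toFun h := WithLp.toLp 2 (f h)
  map_add' g h := by
    ext p
    exact hadd g h p
  map_smul' c h := by
    ext p
    exact hsmul c h p
  norm_map' h := by
    rw [EuclideanSpace.norm_eq, EuclideanSpace.norm_eq, ← hnorm h]
    rfl

/-- The diagonal unitary which changes the sign of the coordinates `j` with `σ j = true`. -/
def signIsometry {ι : Type*} [Fintype ι] (σ : ι → Bool) :
    EuclideanSpace ℂ ι →ₗᵢ[ℂ] EuclideanSpace ℂ ι :=
  isometryOfCoord (fun h j => (if σ j then -1 else 1) * h j)
    (fun g h j => by rw [PiLp.add_apply, mul_add])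
    (fun c h j => by rw [PiLp.smul_apply, smul_eq_mul]; ring)
    (fun h => Finset.sum_congr rfl fun j _ => by split_ifs <;> simp)

theorem signIsometry_apply {ι : Type*} [Fintype ι] (σ : ι → Bool) (h : EuclideanSpace ℂ ι)
    (j : ι) : signIsometry σ h j = (if σ j then -1 else 1) * h j := rfl

/-- The embedding which stores the basis state `j` in the memory register, `idx j` in the index
register and, in the value register, `|-⟩` if `act j = true` and `|+⟩` otherwise. -/
def phaseEmbed {n d : ℕ} {ι : Type*} [Fintype ι] (e : ι ≃ Fin d) (idx : ι → Fin n)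
    (act : ι → Bool) : EuclideanSpace ℂ ι →ₗᵢ[ℂ] QSpace n d :=
  isometryOfCoord (fun h p => if p.1 = idx (e.symm p.2.2) then
      ((√2 : ℝ) : ℂ)⁻¹ * (if act (e.symm p.2.2) && p.2.1 then -1 else 1) * h (e.symm p.2.2)
      else 0)
    (fun g h p => by rw [PiLp.add_apply]; split_ifs <;> ring)
    (fun c h p => by rw [PiLp.smul_apply, smul_eq_mul]; split_ifs <;> ring)
    (fun h => by
      have hσ : ∀ (b : Bool) (j : ι),
          ‖((√2 : ℝ) : ℂ)⁻¹ * (if act j && b then -1 else 1) * h j‖ ^ 2 = ‖h j‖ ^ 2 / 2 := by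
        intro b j
        have h1 : ‖(if act j && b then -1 else 1 : ℂ)‖ = 1 := by split_ifs <;> simp
        rw [norm_mul, norm_mul, h1, mul_one, mul_pow, norm_inv, Complex.norm_real,
          Real.norm_eq_abs, inv_pow, sq_abs, Real.sq_sqrt zero_le_two]
        ring
      rw [Fintype.sum_prod_type, Finset.sum_comm, Fintype.sum_prod_type, Fintype.sum_bool,
        ← Finset.sum_add_distrib, ← e.sum_comp]
      refine Finset.sum_congr rfl fun j _ => ?_
      simp only [Equiv.symm_apply_apply]
      rw [Fintype.sum_eq_single (idx j) fun i hi => by rw [if_neg hi]; simp,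
        Fintype.sum_eq_single (idx j) fun i hi => by rw [if_neg hi]; simp, if_pos rfl,
        if_pos rfl, hσ, hσ]
      ring)

theorem phaseEmbed_apply {n d : ℕ} {ι : Type*} [Fintype ι] (e : ι ≃ Fin d) (idx : ι → Fin n)
    (act : ι → Bool) (h : EuclideanSpace ℂ ι) (p : Fin n × Bool × Fin d) :
    phaseEmbed e idx act h p = if p.1 = idx (e.symm p.2.2) then
      ((√2 : ℝ) : ℂ)⁻¹ * (if act (e.symm p.2.2) && p.2.1 then -1 else 1) * h (e.symm p.2.2)
      else 0 := rfl

theorem oracle_apply {n d : ℕ} (x : Input n) (ψ : QSpace n d) (p : Fin n × Bool × Fin d) :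
    oracle d x ψ p = ψ (p.1, xor p.2.1 (x p.1), p.2.2) := rfl

/-- Phase kickback: XOR with `x_i` multiplies `|-⟩` by `(-1)^{x_i}` and leaves `|+⟩` unchanged, so
`|+⟩` serves as a null query. -/
theorem oracle_phaseEmbed {n d : ℕ} {ι : Type*} [Fintype ι] (e : ι ≃ Fin d) (idx : ι → Fin n)
    (act : ι → Bool) (x : Input n) (h : EuclideanSpace ℂ ι) :
    oracle d x (phaseEmbed e idx act h) =
      phaseEmbed e idx act (signIsometry (fun j => act j && x (idx j)) h) := by
  ext p
  rw [oracle_apply]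
  simp only [phaseEmbed_apply]
  by_cases hp : p.1 = idx (e.symm p.2.2)
  · simp only [hp, if_true, signIsometry_apply]
    cases act (e.symm p.2.2) <;> cases x (idx (e.symm p.2.2)) <;> cases p.2.1 <;> simp
  · simp [hp]

/-- The `k`-th block of a vector. -/
def block {κ ι : Type*} (h : EuclideanSpace ℂ (κ × ι)) (k : κ) : EuclideanSpace ℂ ι :=
  WithLp.toLp 2 fun j => h (k, j)

theorem block_apply {κ ι : Type*} (h : EuclideanSpace ℂ (κ × ι)) (k : κ) (j : ι) :
    block h k j = h (k, j) := rfl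

theorem block_add {κ ι : Type*} (g h : EuclideanSpace ℂ (κ × ι)) (k : κ) :
    block (g + h) k = block g k + block h k := rfl

theorem block_smul {κ ι : Type*} (c : ℂ) (h : EuclideanSpace ℂ (κ × ι)) (k : κ) :
    block (c • h) k = c • block h k := rfl

/-- The isometry acting as `G k` on the `k`-th block. -/
def blockIsometry {κ ι : Type*} [Fintype κ] [Fintype ι]
    (G : κ → EuclideanSpace ℂ ι →ₗᵢ[ℂ] EuclideanSpace ℂ ι) :
    EuclideanSpace ℂ (κ × ι) →ₗᵢ[ℂ] EuclideanSpace ℂ (κ × ι) :=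
  isometryOfCoord (fun h p => G p.1 (block h p.1) p.2)
    (fun g h p => by rw [block_add, map_add, PiLp.add_apply])
    (fun c h p => by rw [block_smul, map_smul, PiLp.smul_apply, smul_eq_mul])
    (fun h => by
      rw [Fintype.sum_prod_type, Fintype.sum_prod_type]
      refine Finset.sum_congr rfl fun k _ => ?_
      simp only
      rw [← EuclideanSpace.norm_sq_eq, LinearIsometry.norm_map, EuclideanSpace.norm_sq_eq]
      rfl)

theorem blockIsometry_apply {κ ι : Type*} [Fintype κ] [Fintype ι]
    (G : κ → EuclideanSpace ℂ ι →ₗᵢ[ℂ] EuclideanSpace ℂ ι) (h : EuclideanSpace ℂ (κ × ι))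
    (k : κ) (j : ι) :
    blockIsometry G h (k, j) = G k (block h k) j := rfl

/-- The mean of the blocks of a vector. -/
def blockMean {κ ι : Type*} [Fintype κ] (h : EuclideanSpace ℂ (κ × ι)) : EuclideanSpace ℂ ι :=
  (Fintype.card κ : ℂ)⁻¹ • ∑ k, block h k

theorem blockMean_apply {κ ι : Type*} [Fintype κ] (h : EuclideanSpace ℂ (κ × ι)) (j : ι) :
    blockMean h j = (Fintype.card κ : ℂ)⁻¹ * ∑ k, h (k, j) := by
  simp [blockMean, block_apply]

theorem blockMean_add {κ ι : Type*} [Fintype κ] (g h : EuclideanSpace ℂ (κ × ι)) :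
    blockMean (g + h) = blockMean g + blockMean h := by
  simp only [blockMean, block_add, Finset.sum_add_distrib, smul_add]

theorem blockMean_smul {κ ι : Type*} [Fintype κ] (c : ℂ) (h : EuclideanSpace ℂ (κ × ι)) :
    blockMean (c • h) = c • blockMean h := by
  simp only [blockMean, block_smul, ← Finset.smul_sum, smul_comm c]

/-- Pythagoras for the mean and the deviations from it, which sum to zero. This is what makes
`meanEmbed` isometric. -/
theorem sum_norm_sq_mean {κ : Type*} [Fintype κ] [Nonempty κ] (c : κ → ℂ) :
    ∑ k, ‖c k‖ ^ 2 = ∑ _k : κ, ‖(Fintype.card κ : ℂ)⁻¹ * ∑ k, c k‖ ^ 2 +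
      ∑ k, ‖c k - (Fintype.card κ : ℂ)⁻¹ * ∑ k, c k‖ ^ 2 := by
  set m := (Fintype.card κ : ℂ)⁻¹ * ∑ k, c k with hm
  have hK : (Fintype.card κ : ℂ) ≠ 0 := by simp
  have h1 : ∑ k, (c k - m) = 0 := by
    rw [Finset.sum_sub_distrib, Finset.sum_const, Finset.card_univ, nsmul_eq_mul, hm,
      mul_inv_cancel_left₀ hK, sub_self]
  have h2 : ∑ k, (2 * (inner ℝ m (c k - m) : ℝ)) = 0 := by
    rw [← Finset.mul_sum, ← inner_sum, h1, inner_zero_right, mul_zero]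
  rw [← Finset.sum_add_distrib, ← sub_eq_zero, ← Finset.sum_sub_distrib, ← h2]
  refine Finset.sum_congr rfl fun k _ => ?_
  have h3 := norm_add_sq_real m (c k - m)
  rw [add_sub_cancel] at h3
  rw [h3]
  ring

/-- The final isometry of the averaging algorithm: it copies into the value register whether the
block register is in the uniform superposition. -/
def meanEmbed {n d : ℕ} [NeZero n] {κ ι : Type*} [Fintype κ] [Nonempty κ] [Fintype ι]
    (e : κ × ι ≃ Fin d) : EuclideanSpace ℂ (κ × ι) →ₗᵢ[ℂ] QSpace n d :=
  isometryOfCoord (fun h p => if p.1 = 0 then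
      (if p.2.1 then blockMean h (e.symm p.2.2).2
        else h (e.symm p.2.2) - blockMean h (e.symm p.2.2).2) else 0)
    (fun g h p => by
      rw [blockMean_add, PiLp.add_apply, PiLp.add_apply]
      split_ifs <;> ring)
    (fun c h p => by
      rw [blockMean_smul, PiLp.smul_apply, PiLp.smul_apply, smul_eq_mul, smul_eq_mul]
      split_ifs <;> ring)
    (fun h => by
      rw [Fintype.sum_prod_type,
        Fintype.sum_eq_single 0 fun i hi => Finset.sum_eq_zero fun q _ => by
          rw [if_neg hi]; simp,
        Fintype.sum_prod_type, Fintype.sum_bool, ← e.sum_comp, ← e.sum_comp]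
      simp only [if_true, Equiv.symm_apply_apply, Bool.false_eq_true, if_false, blockMean_apply]
      rw [Fintype.sum_prod_type_right, Fintype.sum_prod_type_right, Fintype.sum_prod_type_right,
        ← Finset.sum_add_distrib]
      exact Finset.sum_congr rfl fun j _ => (sum_norm_sq_mean fun k => h (k, j)).symm)

theorem meanEmbed_apply {n d : ℕ} [NeZero n] {κ ι : Type*} [Fintype κ] [Nonempty κ]
    [Fintype ι] (e : κ × ι ≃ Fin d) (h : EuclideanSpace ℂ (κ × ι)) (p : Fin n × Bool × Fin d) :
    meanEmbed e h p = if p.1 = 0 then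
      (if p.2.1 then blockMean h (e.symm p.2.2).2
        else h (e.symm p.2.2) - blockMean h (e.symm p.2.2).2) else 0 := rfl

theorem sum_meanEmbed_true {n d : ℕ} [NeZero n] {κ ι : Type*} [Fintype κ] [Nonempty κ]
    [Fintype ι] (e : κ × ι ≃ Fin d) (h : EuclideanSpace ℂ (κ × ι)) :
    ∑ i : Fin n, ∑ w, ‖meanEmbed e h (i, true, w)‖ ^ 2 =
      Fintype.card κ * ‖blockMean h‖ ^ 2 := by
  simp only [meanEmbed_apply]
  rw [Fintype.sum_eq_single 0 fun i hi => Finset.sum_eq_zero fun q _ => by rw [if_neg hi]; simp,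
    ← e.sum_comp]
  simp only [if_true, Equiv.symm_apply_apply]
  rw [Fintype.sum_prod_type, EuclideanSpace.norm_sq_eq]
  simp

namespace Algorithm

theorem norm_state {n T : ℕ} [NeZero n] (A : Algorithm n T) (x : Input n) (t : Fin (T + 1)) :
    ‖A.state x t‖ = 1 := by
  induction t using Fin.induction with
  | zero => simp [state, initState]
  | succ t ih =>
    have h1 : A.state x t.succ = A.U t.succ (oracle A.d x (A.state x t.castSucc)) := by
      simp [state]
    rw [h1, LinearIsometryEquiv.norm_map, LinearIsometryEquiv.norm_map, ih]

theorem outputProb_true_add_false {n T : ℕ} [NeZero n] (A : Algorithm n T) (x : Input n) :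
    A.outputProb x true + A.outputProb x false = 1 := by
  have h := EuclideanSpace.norm_sq_eq (A.state x (Fin.last T))
  rw [norm_state, Fintype.sum_prod_type] at h
  simp only [Fintype.sum_prod_type, Fintype.sum_bool, Finset.sum_add_distrib] at h
  rw [outputProb, outputProb, ← h, one_pow]

end Algorithm

/-! ### Ergodic means as acceptance amplitudes -/

/-- The unitary `Z_x G`, where `Z_x` is the phase query of the index `idx j` in basis state `j`. -/
def queryStep {n : ℕ} {ι : Type*} [Fintype ι] (idx : ι → Option (Fin n))
    (G : EuclideanSpace ℂ ι →ₗᵢ[ℂ] EuclideanSpace ℂ ι) (x : Input n) :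
    EuclideanSpace ℂ ι →ₗᵢ[ℂ] EuclideanSpace ℂ ι :=
  (signIsometry fun j => (idx j).elim false x).comp G

theorem queryStep_apply {n : ℕ} {ι : Type*} [Fintype ι] (idx : ι → Option (Fin n))
    (G : EuclideanSpace ℂ ι →ₗᵢ[ℂ] EuclideanSpace ℂ ι) (x : Input n) (h : EuclideanSpace ℂ ι)
    (j : ι) :
    queryStep idx G x h j = (if (idx j).elim false x then -1 else 1) * G h j := rfl

/-- With `T` queries one can accept with probability `‖(T+1)⁻¹ ∑ₖ (Z_x G)ᵏ ψ‖²`. -/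
theorem exists_algorithm_average {n : ℕ} [NeZero n] {ι : Type*} [Fintype ι]
    (idx : ι → Option (Fin n)) (G : EuclideanSpace ℂ ι →ₗᵢ[ℂ] EuclideanSpace ℂ ι)
    (ψ : EuclideanSpace ℂ ι) (hψ : ‖ψ‖ = 1) (T : ℕ) :
    ∃ A : Algorithm n T, ∀ x, A.outputProb x true =
      ‖((T + 1 : ℕ) : ℂ)⁻¹ • ∑ k : Fin (T + 1), (queryStep idx G x)^[k] ψ‖ ^ 2 := by
  classical
  have hι : Nonempty ι := by
    by_contra h
    rw [not_nonempty_iff] at h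
    simp [EuclideanSpace.norm_eq] at hψ
  let e := Fintype.equivFin (Fin (T + 1) × ι)
  have hd : 0 < Fintype.card (Fin (T + 1) × ι) := Fintype.card_pos
  -- Block `k` takes part in the first `k` rounds only and then idles.
  let act : Fin T → Fin (T + 1) × ι → Bool := fun t p =>
    decide (t.castSucc < p.1) && (idx p.2).isSome
  let E : Fin T → EuclideanSpace ℂ (Fin (T + 1) × ι) →ₗᵢ[ℂ] QSpace n _ := fun t =>
    phaseEmbed e (fun p => (idx p.2).getD 0) (act t)
  let V : Fin T → EuclideanSpace ℂ (Fin (T + 1) × ι) →ₗᵢ[ℂ] EuclideanSpace ℂ (Fin (T + 1) × ι) :=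
    fun t => blockIsometry fun k => if t.castSucc < k then G else LinearIsometry.id
  let c : ℂ := ((√((T + 1 : ℕ) : ℝ) : ℝ) : ℂ)⁻¹
  have hc : ‖c‖ ^ 2 = ((T + 1 : ℕ) : ℝ)⁻¹ := by
    simp only [c]
    rw [norm_inv, Complex.norm_real, Real.norm_eq_abs, inv_pow, sq_abs,
      Real.sq_sqrt (Nat.cast_nonneg _)]
  -- After `t` rounds block `k` holds the `min k t`-th iterate; `c` normalizes the superposition of
  -- `T + 1` blocks.
  let s : Input n → Fin (T + 1) → EuclideanSpace ℂ (Fin (T + 1) × ι) := fun x t =>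
    WithLp.toLp 2 fun p => (c • (queryStep idx G x)^[min p.1.val t.val] ψ) p.2
  let ψ' : EuclideanSpace ℂ (Fin (T + 1) × ι) := WithLp.toLp 2 fun p => (c • ψ) p.2
  have hψ' : ‖ψ'‖ = 1 := by
    have h1 : ‖ψ'‖ ^ 2 = 1 := by
      rw [EuclideanSpace.norm_sq_eq, Fintype.sum_prod_type]
      simp only [ψ', ← EuclideanSpace.norm_sq_eq]
      rw [norm_smul, hψ, mul_one, hc, Finset.sum_const, Finset.card_univ, Fintype.card_fin,
        nsmul_eq_mul]
      exact mul_inv_cancel₀ (by positivity)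
    exact (pow_eq_one_iff_of_nonneg (norm_nonneg _) two_ne_zero).1 h1
  obtain ⟨A, hA⟩ := exists_algorithm_of_process hd
    (Fin.lastCases (meanEmbed e) fun t => (E t).comp (V t)) E ψ' hψ' s
    (fun x => by ext p; simp [s, ψ']) (by
      intro x t
      rw [Fin.lastCases_castSucc]
      refine (oracle_phaseEmbed e (fun p => (idx p.2).getD 0) (act t) x
        (V t (s x t.castSucc))).trans ?_
      refine congrArg (E t) ?_
      ext ⟨k, j⟩
      have hblock : ∀ t, block (s x t) k =
        c • (queryStep idx G x)^[min k.val t.val] ψ := fun t => rfl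
      rw [signIsometry_apply, blockIsometry_apply, hblock, ← block_apply, hblock]
      by_cases hk : t.castSucc < k
      · have h0 : t.val < k.val := hk
        have h1 : min k.val t.castSucc.val = t.val := by
          simpa using h0.le
        have h2 : min k.val t.succ.val = t.val + 1 := by
          simpa using h0
        rw [if_pos hk, h1, h2, Function.iterate_succ_apply', map_smul, PiLp.smul_apply,
          PiLp.smul_apply, queryStep_apply, smul_eq_mul, smul_eq_mul, mul_left_comm]
        generalize G _ = y
        simp only [act, hk, decide_true, Bool.true_and]
        cases idx j with
        | none => simp
        | some i => cases hi : x i <;> simp [hi]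
      · have h0 : ¬ t.val < k.val := hk
        have h1 : min k.val t.castSucc.val = k.val := by
          simpa using h0
        have h2 : min k.val t.succ.val = k.val := by
          simp; omega
        rw [if_neg hk, h1, h2]
        simp [act, hk])
  refine ⟨A, fun x => ?_⟩
  rw [hA, Fin.lastCases_last, sum_meanEmbed_true]
  have hmean : blockMean (s x (Fin.last T)) =
      c • ((T + 1 : ℕ) : ℂ)⁻¹ • ∑ k : Fin (T + 1), (queryStep idx G x)^[k] ψ := by
    have hblock : ∀ k, block (s x (Fin.last T)) k = c • (queryStep idx G x)^[k.val] ψ := by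
      intro k
      have hk : min k.val (Fin.last T).val = k.val := min_eq_left (Fin.le_last k)
      rw [← hk]
      rfl
    simp only [blockMean, hblock, ← Finset.smul_sum, Fintype.card_fin]
    rw [smul_comm]
  rw [hmean, norm_smul, mul_pow, hc, Fintype.card_fin, mul_inv_cancel_left₀ (by positivity)]

/-! ### Algorithms from vector realizations -/

/-- A fixed vector of an isometry `U` bounds the ergodic means of `U` from below. -/
theorem one_le_norm_sq_mul_of_fixed {H : Type*} [NormedAddCommGroup H] [InnerProductSpace ℂ H]
    (U : H →ₗᵢ[ℂ] H) {t ψ : H} (ht : U t = t) (h : inner ℂ t ψ = 1) (T : ℕ) :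
    1 ≤ ‖t‖ ^ 2 * ‖((T + 1 : ℕ) : ℂ)⁻¹ • ∑ k : Fin (T + 1), U^[k] ψ‖ ^ 2 := by
  have h1 : ∀ k : ℕ, inner ℂ t (U^[k] ψ) = 1 := by
    intro k
    induction k with
    | zero => simpa using h
    | succ k ih =>
      rw [Function.iterate_succ_apply']
      nth_rw 1 [← ht]
      rw [LinearIsometry.inner_map_map, ih]
  have h2 : inner ℂ t (((T + 1 : ℕ) : ℂ)⁻¹ • ∑ k : Fin (T + 1), U^[k] ψ) = 1 := by
    rw [inner_smul_right, inner_sum, Finset.sum_congr rfl fun k _ => h1 k.val, Finset.sum_const,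
      Finset.card_univ, Fintype.card_fin, nsmul_eq_mul, mul_one]
    exact inv_mul_cancel₀ (Nat.cast_ne_zero.2 (Nat.succ_ne_zero T))
  have h3 := norm_inner_le_norm (𝕜 := ℂ) t (((T + 1 : ℕ) : ℂ)⁻¹ • ∑ k : Fin (T + 1), U^[k] ψ)
  rw [h2, norm_one] at h3
  rw [← mul_pow]
  exact one_le_pow₀ h3

/-- The ergodic means of a coboundary are small. -/
theorem norm_mean_coboundary_le {H : Type*} [NormedAddCommGroup H] [InnerProductSpace ℂ H]
    (U : H →ₗᵢ[ℂ] H) {φ ψ : H} (h : U φ = φ - (2 : ℂ) • ψ) (T : ℕ) :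
    ‖((T + 1 : ℕ) : ℂ)⁻¹ • ∑ k : Fin (T + 1), U^[k] ψ‖ ≤ ‖φ‖ / (T + 1 : ℕ) := by
  have hiter : ∀ k : ℕ, ‖U^[k] φ‖ = ‖φ‖ := by
    intro k
    induction k with
    | zero => rfl
    | succ k ih => rw [Function.iterate_succ_apply', LinearIsometry.norm_map, ih]
  have hsub : ∀ k : ℕ, U^[k + 1] φ = U^[k] φ - (2 : ℂ) • U^[k] ψ := by
    intro k
    induction k with
    | zero => simpa using h
    | succ k ih =>
      simpa only [map_sub, map_smul, ← Function.iterate_succ_apply'] using congrArg U ih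
  -- Each `2 U^k ψ` is `U^k φ - U^(k+1) φ`, so the sum telescopes.
  have hsum : ∀ K : ℕ, (2 : ℂ) • ∑ k ∈ Finset.range K, U^[k] ψ = φ - U^[K] φ := by
    intro K
    induction K with
    | zero => simp
    | succ K ih => rw [Finset.sum_range_succ, smul_add, ih, hsub]; abel
  have h2 : 2 * ‖∑ k ∈ Finset.range (T + 1), U^[k] ψ‖ ≤ 2 * ‖φ‖ := by
    have h3 := congrArg norm (hsum (T + 1))
    rw [norm_smul, Complex.norm_ofNat] at h3
    rw [h3]
    refine (norm_sub_le _ _).trans ?_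
    rw [hiter, two_mul]
  rw [Fin.sum_univ_eq_sum_range fun k => U^[k] ψ, norm_smul, norm_inv, Complex.norm_natCast,
    div_eq_inv_mul]
  exact mul_le_mul_of_nonneg_left (by linarith) (by positivity)

/-! ### Witness states and the walk operator -/

/-- The vector `|0⟩ + α ∑ᵢ |i, zᵢ⟩ ⊗ uᵢ`, where `none` is the index of the basis state `|0⟩`. -/
def witness {n d : ℕ} (z : Input n) (α : ℝ) (u : Fin n → EuclideanSpace ℂ (Fin d)) :
    EuclideanSpace ℂ (Option (Fin n × Bool × Fin d)) :=
  WithLp.toLp 2 fun j => j.elim 1 fun p => if p.2.1 = z p.1 then (α : ℂ) * u p.1 p.2.2 else 0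

theorem witness_none {n d : ℕ} (z : Input n) (α : ℝ) (u : Fin n → EuclideanSpace ℂ (Fin d)) :
    witness z α u none = 1 := rfl

theorem witness_some {n d : ℕ} (z : Input n) (α : ℝ) (u : Fin n → EuclideanSpace ℂ (Fin d))
    (i : Fin n) (b : Bool) (k : Fin d) :
    witness z α u (some (i, b, k)) = if b = z i then (α : ℂ) * u i k else 0 := rfl

/-- The supports meet only at indices where the two strings agree. When one string is complemented
these are the indices where the original inputs differ, as in the realization condition. -/
theorem inner_witness {n d : ℕ} (y z : Input n) (α β : ℝ)
    (u v : Fin n → EuclideanSpace ℂ (Fin d)) :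
    inner ℂ (witness y α u) (witness z β v) =
      1 + α * β * ∑ i ∈ Finset.univ.filter (fun i => y i = z i), inner ℂ (u i) (v i) := by
  simp only [PiLp.inner_apply, Fintype.sum_option, witness_none, Fintype.sum_prod_type,
    witness_some]
  congr 1
  · simp
  rw [Finset.mul_sum, Finset.sum_filter]
  refine Finset.sum_congr rfl fun i _ => ?_
  rw [Fintype.sum_bool, Finset.mul_sum]
  cases y i <;> cases z i <;> simp <;>
    exact Finset.sum_congr rfl fun k _ => by ring

theorem norm_sq_witness {n d : ℕ} (z : Input n) (α : ℝ)
    (u : Fin n → EuclideanSpace ℂ (Fin d)) :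
    ‖witness z α u‖ ^ 2 = 1 + α ^ 2 * ∑ i, ‖u i‖ ^ 2 := by
  have h := inner_witness z z α α u u
  simp only [inner_self_eq_norm_sq_to_K, Finset.filter_true] at h
  have h2 : ((‖witness z α u‖ : ℝ) : ℂ) ^ 2 =
    1 + (α : ℂ) * (α : ℂ) * ∑ i, ((‖u i‖ : ℝ) : ℂ) ^ 2 := h
  rw [pow_two α]
  exact_mod_cast h2

/-- The index queried by a basis state. -/
def workIdx {n d : ℕ} (j : Option (Fin n × Bool × Fin d)) : Option (Fin n) := j.map fun p => p.1

/-- The input-independent part of the walk operator. -/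
def walkUnitary {n d : ℕ} (S : Submodule ℂ (EuclideanSpace ℂ (Option (Fin n × Bool × Fin d)))) :
    EuclideanSpace ℂ (Option (Fin n × Bool × Fin d)) →ₗᵢ[ℂ]
      EuclideanSpace ℂ (Option (Fin n × Bool × Fin d)) :=
  (signIsometry fun j => j.elim false fun p => p.2.1).comp Sᗮ.reflection.toLinearIsometry

theorem walkUnitary_apply {n d : ℕ}
    (S : Submodule ℂ (EuclideanSpace ℂ (Option (Fin n × Bool × Fin d))))
    (h : EuclideanSpace ℂ (Option (Fin n × Bool × Fin d))) (j : Option (Fin n × Bool × Fin d)) :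
    walkUnitary S h j =
      (if j.elim false fun p => p.2.1 then -1 else 1) * Sᗮ.reflection h j := rfl

/-- The fixed sign `(-1)^b` times the query sign `(-1)^{x_i}` is `+1` exactly when `b = x_i`, which
is where this witness is supported. -/
theorem queryStep_walkUnitary_witness {n d : ℕ}
    (S : Submodule ℂ (EuclideanSpace ℂ (Option (Fin n × Bool × Fin d)))) (x : Input n) (α : ℝ)
    (u : Fin n → EuclideanSpace ℂ (Fin d)) (h : witness x α u ∈ Sᗮ) :
    queryStep workIdx (walkUnitary S) x (witness x α u) = witness x α u := by
  ext j
  rw [queryStep_apply, walkUnitary_apply, (Submodule.reflection_eq_self_iff _).2 h]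
  rcases j with _ | ⟨i, b, k⟩
  · simp [workIdx]
  · rw [witness_some]
    simp only [workIdx, Option.map_some, Option.elim_some]
    rcases Bool.eq_false_or_eq_true (x i) with hx | hx <;> cases b <;> simp [hx]

/-- The reflection negates the vector, and the signs negate it again everywhere except at `none`,
where the entry `1` becomes `-1 = 1 - 2`. -/
theorem queryStep_walkUnitary_witness_not {n d : ℕ}
    (S : Submodule ℂ (EuclideanSpace ℂ (Option (Fin n × Bool × Fin d)))) (x : Input n) (α : ℝ)
    (u : Fin n → EuclideanSpace ℂ (Fin d)) (h : witness (fun i => !x i) α u ∈ S) :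
    queryStep workIdx (walkUnitary S) x (witness (fun i => !x i) α u) =
      witness (fun i => !x i) α u - (2 : ℂ) • EuclideanSpace.single none 1 := by
  have hS : Sᗮ.reflection (witness (fun i => !x i) α u) = -witness (fun i => !x i) α u :=
    Submodule.reflection_mem_subspace_orthogonal_precomplement_eq_neg h
  ext j
  rw [queryStep_apply, walkUnitary_apply, hS, PiLp.sub_apply, PiLp.smul_apply, PiLp.neg_apply]
  rcases j with _ | ⟨i, b, k⟩
  · simp [workIdx, witness_none]
    norm_num
  · rw [witness_some]
    simp only [workIdx, Option.map_some, Option.elim_some]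
    rcases Bool.eq_false_or_eq_true (x i) with hx | hx <;> cases b <;> simp [hx]

/-! ### The algorithm and its parameters -/

theorem sum_norm_sq_le_realizationValue {n d : ℕ} (w : Input n → Fin n → EuclideanSpace ℂ (Fin d))
    (x : Input n) : ∑ i, ‖w x i‖ ^ 2 ≤ realizationValue w :=
  Finset.le_sup' (fun x : Input n => ∑ i : Fin n, ‖w x i‖ ^ 2) (Finset.mem_univ x)

theorem realizationValue_nonneg {n d : ℕ} (w : Input n → Fin n → EuclideanSpace ℂ (Fin d)) :
    0 ≤ realizationValue w :=
  (Finset.sum_nonneg fun _ _ => sq_nonneg _).trans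
    (sum_norm_sq_le_realizationValue w fun _ => false)

/-- Cauchy–Schwarz and the arithmetic-geometric mean inequality. It allows additive constants, such
as rounding up the number of queries, to be absorbed in the value. -/
theorem one_le_realizationValue {n d : ℕ} {f : Input n → Bool}
    {w : Input n → Fin n → EuclideanSpace ℂ (Fin d)} (hw : IsVectorRealization f w)
    {x y : Input n} (hxy : f x ≠ f y) : 1 ≤ realizationValue w := by
  have h1 : (1 : ℝ) ≤ ∑ i, ‖w x i‖ * ‖w y i‖ := by
    have h := congrArg norm (hw x y hxy)
    rw [norm_one] at h
    rw [← h]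
    refine (norm_sum_le _ _).trans ((Finset.sum_le_sum fun i _ => norm_inner_le_norm _ _).trans ?_)
    exact Finset.sum_le_univ_sum_of_nonneg fun i => by positivity
  have h2 : ∑ i, ‖w x i‖ * ‖w y i‖ ≤ (∑ i, ‖w x i‖ ^ 2 + ∑ i, ‖w y i‖ ^ 2) / 2 := by
    rw [← Finset.sum_add_distrib, Finset.sum_div]
    exact Finset.sum_le_sum fun i _ => by nlinarith [sq_nonneg (‖w x i‖ - ‖w y i‖)]
  linarith [sum_norm_sq_le_realizationValue w x, sum_norm_sq_le_realizationValue w y]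

theorem exists_algorithm_of_const {n : ℕ} [NeZero n] {f : Input n → Bool} (b : Bool)
    (hf : ∀ x, f x = b) : ∃ A : Algorithm n 0, A.Computes f := by
  -- The oracle of the constant string `b`, used as `U_0`, writes `b` into the value register
  -- without a query.
  refine ⟨⟨1, one_pos, fun _ => oracle 1 fun _ => b⟩, fun x => ?_⟩
  have : (⟨1, one_pos, fun _ => oracle 1 fun _ => b⟩ : Algorithm n 0).state x (Fin.last 0) =
      EuclideanSpace.single (0, b, 0) 1 := by
    simp [Algorithm.state, Algorithm.initState, oracle_basis]
  rw [Algorithm.outputProb, this, hf x,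
    Fintype.sum_eq_single 0 fun i hi => by simp [hi]]
  simp
  norm_num

theorem exists_algorithm_of_realization {n : ℕ} [NeZero n] {f : Input n → Bool} {d : ℕ}
    {w : Input n → Fin n → EuclideanSpace ℂ (Fin d)} (hw : IsVectorRealization f w) :
    ∃ (T : ℕ) (A : Algorithm n T), A.Computes f ∧ (T : ℝ) ≤ 5 * realizationValue w := by
  by_cases hconst : ∀ x y, f x = f y
  · obtain ⟨A, hA⟩ := exists_algorithm_of_const (f (fun _ => false)) fun x => hconst x _
    exact ⟨0, A, hA, by simpa using realizationValue_nonneg w⟩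
  push Not at hconst
  obtain ⟨x₀, y₀, hxy⟩ := hconst
  set W := realizationValue w with hW
  have hW1 : 1 ≤ W := one_le_realizationValue hw hxy
  -- This scale makes `‖t_x‖² ≤ 1 + 1/3`, giving acceptance at least `3/4`, and `‖φ_x‖² ≤ 1 + 3W² ≤
  -- 4W²`.
  set α : ℝ := (√(3 * W))⁻¹ with hα
  have hα0 : α ≠ 0 := by positivity
  have hα2 : α ^ 2 = (3 * W)⁻¹ := by
    rw [hα, inv_pow, Real.sq_sqrt (by positivity)]
  let φ : Input n → EuclideanSpace ℂ (Option (Fin n × Bool × Fin d)) := fun y =>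
    witness (fun i => !y i) (-α⁻¹) (w y)
  let S := Submodule.span ℂ (φ '' {y | f y = false})
  have hS : ∀ x, f x = true → witness x α (w x) ∈ Sᗮ := by
    intro x hx
    rw [Submodule.mem_orthogonal]
    intro v hv
    refine Submodule.span_induction ?_ ?_ ?_ ?_ hv
    · rintro _ ⟨y, hy, rfl⟩
      have hyx : f y ≠ f x := by
        rw [hx, show f y = false from hy]
        simp
      have h := hw y x hyx
      rw [inner_witness]
      have hfilter : Finset.univ.filter (fun i => (!y i) = x i) =
          Finset.univ.filter (fun i => y i ≠ x i) := by
        ext i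
        cases hy : y i <;> cases hx : x i <;> simp [hy, hx]
      rw [hfilter, h]
      have : (α : ℂ) ≠ 0 := Complex.ofReal_ne_zero.2 hα0
      push_cast
      field_simp
      norm_num
    · simp
    · intro a b _ _ ha hb
      rw [inner_add_left, ha, hb, add_zero]
    · intro c a _ ha
      rw [inner_smul_left, ha, mul_zero]
  -- With at least `4W` terms the mean has norm at most `2W / 4W = 1/2` when `f x = 0`, so
  -- acceptance is at most `1/4`.
  obtain ⟨A, hA⟩ := exists_algorithm_average (n := n) workIdx (walkUnitary S)
    (EuclideanSpace.single none 1) (by simp) ⌈4 * W⌉₊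
  refine ⟨_, A, fun x => ?_, ?_⟩
  · have hsum := sum_norm_sq_le_realizationValue w x
    rw [← hW] at hsum
    cases hx : f x with
    | true =>
      rw [hA]
      have h1 := one_le_norm_sq_mul_of_fixed _
        (queryStep_walkUnitary_witness S x α (w x) (hS x hx))
        (ψ := EuclideanSpace.single none 1)
        (by rw [EuclideanSpace.inner_single_right, witness_none]; simp) ⌈4 * W⌉₊
      have h2 : ‖witness x α (w x)‖ ^ 2 ≤ 4 / 3 := by
        rw [norm_sq_witness, hα2]
        have : (3 * W)⁻¹ * ∑ i, ‖w x i‖ ^ 2 ≤ (3 * W)⁻¹ * W :=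
          mul_le_mul_of_nonneg_left hsum (by positivity)
        have h3 : (3 * W)⁻¹ * W = 1 / 3 := by field_simp
        linarith
      have h3 := h1.trans (mul_le_mul_of_nonneg_right h2 (sq_nonneg _))
      linarith
    | false =>
      have h0 := A.outputProb_true_add_false x
      have h1 := norm_mean_coboundary_le _
        (queryStep_walkUnitary_witness_not S x (-α⁻¹) (w x)
          (Submodule.subset_span ⟨x, hx, rfl⟩)) ⌈4 * W⌉₊
      have h2 : ‖φ x‖ ≤ 2 * W := by
        refine abs_le_of_sq_le_sq' ?_ (by positivity) |>.2
        rw [norm_sq_witness, neg_sq, inv_pow, hα2, inv_inv]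
        nlinarith
      have h3 : 4 * W ≤ ((⌈4 * W⌉₊ + 1 : ℕ) : ℝ) := by
        push_cast
        linarith [Nat.le_ceil (4 * W)]
      have h4 : ‖φ x‖ / ((⌈4 * W⌉₊ + 1 : ℕ) : ℝ) ≤ 1 / 2 := by
        rw [div_le_iff₀ (by positivity)]
        linarith
      have h5 : A.outputProb x true ≤ (1 / 2) ^ 2 := by
        rw [hA]
        exact pow_le_pow_left₀ (norm_nonneg _) (h1.trans h4) 2
      linarith
  · linarith [Nat.ceil_lt_add_one (show 0 ≤ 4 * W by positivity)]

/-! ### The adversary bound -/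

/-! ### Spectral norms through bilinear forms -/

theorem specNorm_nonneg {n : ℕ} (M : Matrix (Input n) (Input n) ℝ) : 0 ≤ specNorm M :=
  norm_nonneg _

theorem sum_mul_mul_eq_inner {n : ℕ} (M : Matrix (Input n) (Input n) ℝ)
    (a b : EuclideanSpace ℝ (Input n)) :
    ∑ x, ∑ y, M x y * (a x * b y) =
      inner ℝ a (Matrix.toEuclideanCLM (n := Input n) (𝕜 := ℝ) M b) := by
  rw [PiLp.inner_apply]
  refine Finset.sum_congr rfl fun x _ => ?_
  rw [toEuclideanCLM_coord]
  simp only [RCLike.inner_apply, conj_trivial, Finset.sum_mul]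
  exact Finset.sum_congr rfl fun y _ => by ring

theorem sum_mul_mul_le_specNorm {n : ℕ} (M : Matrix (Input n) (Input n) ℝ) (a b : Input n → ℝ)
    {s : ℝ} (hs : 0 < s) :
    ∑ x, ∑ y, M x y * (a x * b y) ≤
      specNorm M * ((s * ∑ x, a x ^ 2 + s⁻¹ * ∑ y, b y ^ 2) / 2) := by
  have h := sum_mul_mul_eq_inner M (WithLp.toLp 2 a) (WithLp.toLp 2 b)
  simp only at h
  rw [h]
  set A := (WithLp.toLp 2 a : EuclideanSpace ℝ (Input n))
  set B := (WithLp.toLp 2 b : EuclideanSpace ℝ (Input n))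
  have hA : ∑ x, a x ^ 2 = ‖A‖ ^ 2 := by simp [A, EuclideanSpace.norm_sq_eq]
  have hB : ∑ x, b x ^ 2 = ‖B‖ ^ 2 := by simp [B, EuclideanSpace.norm_sq_eq]
  rw [hA, hB]
  have h1 := (real_inner_le_norm A _).trans (mul_le_mul_of_nonneg_left
    ((Matrix.toEuclideanCLM (n := Input n) (𝕜 := ℝ) M).le_opNorm B) (norm_nonneg A))
  have h2 : ‖A‖ * ‖B‖ ≤ (s * ‖A‖ ^ 2 + s⁻¹ * ‖B‖ ^ 2) / 2 := by
    have h3 : 0 ≤ s⁻¹ * (s * ‖A‖ - ‖B‖) ^ 2 := by positivity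
    have h4 : s⁻¹ * (s * ‖A‖ - ‖B‖) ^ 2 = s * ‖A‖ ^ 2 + s⁻¹ * ‖B‖ ^ 2 - 2 * (‖A‖ * ‖B‖) := by
      field_simp
      ring
    linarith
  calc _ ≤ _ := h1
    _ = specNorm M * (‖A‖ * ‖B‖) := by rw [specNorm]; ring
    _ ≤ _ := mul_le_mul_of_nonneg_left h2 (specNorm_nonneg M)

theorem specNorm_le_of_sum_le {n : ℕ} (M : Matrix (Input n) (Input n) ℝ) {C : ℝ} (hC : 0 ≤ C)
    (h : ∀ a b : Input n → ℝ, ∑ x, ∑ y, M x y * (a x * b y) ≤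
      C * ((∑ x, a x ^ 2 + ∑ y, b y ^ 2) / 2)) : specNorm M ≤ C := by
  refine ContinuousLinearMap.opNorm_le_bound _ hC fun v => ?_
  set u := Matrix.toEuclideanCLM (n := Input n) (𝕜 := ℝ) M v with hu
  -- The rescaled vectors have equal norms, so the arithmetic mean in the hypothesis loses nothing
  -- against the product.
  have h1 := h (‖v‖ • u) (‖u‖ • v)
  have h2 := sum_mul_mul_eq_inner M (‖v‖ • u) (‖u‖ • v)
  have hA : ∑ x, (‖v‖ • u) x ^ 2 = (‖v‖ * ‖u‖) ^ 2 := by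
    have := EuclideanSpace.norm_sq_eq (‖v‖ • u)
    rw [norm_smul, norm_norm] at this
    simp only [Real.norm_eq_abs, sq_abs] at this
    exact this.symm
  have hB : ∑ x, (‖u‖ • v) x ^ 2 = (‖u‖ * ‖v‖) ^ 2 := by
    have := EuclideanSpace.norm_sq_eq (‖u‖ • v)
    rw [norm_smul, norm_norm] at this
    simp only [Real.norm_eq_abs, sq_abs] at this
    exact this.symm
  rw [map_smul, ← hu, inner_smul_left, inner_smul_right, real_inner_self_eq_norm_sq] at h2
  simp only [conj_trivial] at h2
  have h3 : ‖v‖ * (‖u‖ * ‖u‖ ^ 2) ≤ C * (‖v‖ * ‖u‖) ^ 2 := by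
    refine h2.symm.le.trans (h1.trans (le_of_eq ?_))
    simp only [PiLp.smul_apply, Pi.smul_apply] at hA hB ⊢
    rw [hA, hB]
    ring
  rcases (norm_nonneg v).eq_or_lt with hv | hv
  · rw [hu, norm_eq_zero.1 hv.symm, map_zero, norm_zero, mul_zero]
  rcases (norm_nonneg u).eq_or_lt with hu0 | hu0
  · rw [← hu0]
    positivity
  have h4 : (‖v‖ * ‖u‖ ^ 2) * ‖u‖ ≤ (‖v‖ * ‖u‖ ^ 2) * (C * ‖v‖) := by linarith
  exact le_of_mul_le_mul_left h4 (by positivity)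

theorem sum_re_conj_mul_le_specNorm {n : ℕ} (M : Matrix (Input n) (Input n) ℝ)
    (p q : Input n → ℂ) {s : ℝ} (hs : 0 < s) :
    ∑ x, ∑ y, M x y * (starRingEnd ℂ (p x) * q y).re ≤
      specNorm M * ((s * ∑ x, ‖p x‖ ^ 2 + s⁻¹ * ∑ y, ‖q y‖ ^ 2) / 2) := by
  have h1 := sum_mul_mul_le_specNorm M (fun x => (p x).re) (fun y => (q y).re) hs
  have h2 := sum_mul_mul_le_specNorm M (fun x => (p x).im) (fun y => (q y).im) hs
  have h3 : ∀ z : ℂ, ‖z‖ ^ 2 = z.re ^ 2 + z.im ^ 2 := fun z => by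
    rw [← Complex.normSq_eq_norm_sq, Complex.normSq_apply]
    ring
  simp only [h3, Finset.sum_add_distrib]
  have h4 : ∑ x, ∑ y, M x y * (starRingEnd ℂ (p x) * q y).re =
      ∑ x, ∑ y, M x y * ((p x).re * (q y).re) + ∑ x, ∑ y, M x y * ((p x).im * (q y).im) := by
    simp only [← Finset.sum_add_distrib]
    refine Finset.sum_congr rfl fun x _ => Finset.sum_congr rfl fun y _ => ?_
    simp
    ring
  rw [h4]
  linarith

/-- A weighted form of `sum_re_conj_mul_le_specNorm` for families of coordinates. -/
theorem sum_weight_re_le {n : ℕ} {ι : Type*} [Fintype ι]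
    (M : ι → Matrix (Input n) (Input n) ℝ) {N : ℝ} (hM : ∀ c, specNorm (M c) ≤ N)
    (u v : Input n → ℝ) (p q : Input n → ι → ℂ) {s : ℝ} (hs : 0 < s) :
    ∑ x, ∑ y, u x * v y * ∑ c, M c x y * (starRingEnd ℂ (p x c) * q y c).re ≤
      N * ((s * ∑ x, u x ^ 2 * ∑ c, ‖p x c‖ ^ 2 + s⁻¹ * ∑ y, v y ^ 2 * ∑ c, ‖q y c‖ ^ 2) / 2) := by
  have h : ∀ c, ∑ x, ∑ y, u x * v y * (M c x y * (starRingEnd ℂ (p x c) * q y c).re) ≤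
      N * ((s * ∑ x, u x ^ 2 * ‖p x c‖ ^ 2 + s⁻¹ * ∑ y, v y ^ 2 * ‖q y c‖ ^ 2) / 2) := by
    intro c
    have h1 := sum_re_conj_mul_le_specNorm (M c) (fun x => u x * p x c) (fun y => v y * q y c) hs
    have h2 : ∀ (r : ℝ) (z : ℂ), ‖(r : ℂ) * z‖ ^ 2 = r ^ 2 * ‖z‖ ^ 2 := fun r z => by
      rw [norm_mul, mul_pow, Complex.norm_real, Real.norm_eq_abs, sq_abs]
    simp only [h2] at h1
    refine le_trans (le_of_eq ?_) (h1.trans (mul_le_mul_of_nonneg_right (hM c) ?_))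
    · refine Finset.sum_congr rfl fun x _ => Finset.sum_congr rfl fun y _ => ?_
      have : starRingEnd ℂ (u x * p x c) * (v y * q y c) =
          ((u x * v y : ℝ) : ℂ) * (starRingEnd ℂ (p x c) * q y c) := by
        rw [map_mul, Complex.conj_ofReal]
        push_cast
        ring
      rw [this, Complex.re_ofReal_mul]
      ring
    · have := hs.le
      positivity
  have h5 := Finset.sum_le_sum fun c (_ : c ∈ Finset.univ) => h c
  refine le_trans (le_of_eq ?_) (h5.trans (le_of_eq ?_))
  · simp only [Finset.mul_sum]
    rw [Finset.sum_comm' (t' := Finset.univ) (s' := fun _ => Finset.univ) (by simp)]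
    rw [Finset.sum_comm]
    rw [Finset.sum_comm (s := (Finset.univ : Finset ι))]
    refine Finset.sum_congr rfl fun x _ => ?_
    rw [Finset.sum_comm]
  · rw [← Finset.mul_sum, ← Finset.sum_div, Finset.sum_add_distrib, ← Finset.mul_sum,
      ← Finset.mul_sum, Finset.sum_comm, Finset.sum_comm (s := (Finset.univ : Finset ι))]
    simp only [Finset.mul_sum]

theorem specNorm_punctured_le {n : ℕ} [NeZero n] (Γ : Matrix (Input n) (Input n) ℝ) (i : Fin n) :
    specNorm (punctured Γ i) ≤ maxPuncturedNorm Γ :=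
  Finset.le_sup' (fun i : Fin n => specNorm (punctured Γ i)) (Finset.mem_univ i)

theorem maxPuncturedNorm_nonneg {n : ℕ} [NeZero n] (Γ : Matrix (Input n) (Input n) ℝ) :
    0 ≤ maxPuncturedNorm Γ :=
  (specNorm_nonneg _).trans (specNorm_punctured_le Γ 0)

/-! ### The progress measure of an algorithm -/

theorem inner_eq_sum_conj_mul {κ : Type*} [Fintype κ] (ψ φ : EuclideanSpace ℂ κ) :
    inner ℂ ψ φ = ∑ c, starRingEnd ℂ (ψ c) * φ c := by
  rw [PiLp.inner_apply]
  exact Finset.sum_congr rfl fun c _ => by rw [RCLike.inner_apply, mul_comm]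

/-- Where `x` and `y` agree the oracle calls cancel; elsewhere they pair an amplitude with the one
whose value bit is flipped. So a query affects only entries of the punctured matrices. -/
theorem inner_oracle {n d : ℕ} (x y : Input n) (ψ φ : QSpace n d) :
    inner ℂ (oracle d x ψ) (oracle d y φ) =
      ∑ c, starRingEnd ℂ (ψ c) * φ (if x c.1 = y c.1 then c else (c.1, !c.2.1, c.2.2)) := by
  rw [inner_eq_sum_conj_mul, ← Equiv.sum_comp (oraclePerm d x)]
  refine Finset.sum_congr rfl fun c _ => ?_
  obtain ⟨i, b, w⟩ := c
  rw [oracle_apply, oracle_apply]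
  simp only [oraclePerm, Equiv.coe_fn_mk]
  rcases Bool.eq_false_or_eq_true (x i) with hx | hx <;>
    rcases Bool.eq_false_or_eq_true (y i) with hy | hy <;> simp [hx, hy]

/-- A query changes the progress measure by at most the norms of the punctured matrices. -/
theorem query_progress {n d : ℕ} [NeZero n] (Γ : Matrix (Input n) (Input n) ℝ)
    (ψ : Input n → QSpace n d) (hψ : ∀ x, ‖ψ x‖ = 1) (u v : Input n → ℝ) :
    ∑ x, ∑ y, Γ x y * (u x * v y) * (inner ℂ (ψ x) (ψ y)).re ≤
      ∑ x, ∑ y, Γ x y * (u x * v y) * (inner ℂ (oracle d x (ψ x)) (oracle d y (ψ y))).re +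
        maxPuncturedNorm Γ * (∑ x, u x ^ 2 + ∑ y, v y ^ 2) := by
  have h1 : ∀ x, ∑ c, ‖ψ x c‖ ^ 2 = 1 := fun x => by
    rw [← EuclideanSpace.norm_sq_eq, hψ, one_pow]
  let flip : Equiv.Perm (Fin n × Bool × Fin d) := oraclePerm d fun _ => true
  have h2 : ∀ x, ∑ c, ‖-ψ x (flip c)‖ ^ 2 = 1 := fun x => by
    rw [← h1 x, ← Equiv.sum_comp flip fun c => ‖ψ x c‖ ^ 2]
    simp only [norm_neg]
  have hb1 := sum_weight_re_le (fun c : Fin n × Bool × Fin d => punctured Γ c.1)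
    (fun c => specNorm_punctured_le Γ c.1) u v (fun x c => ψ x c) (fun y c => ψ y c) one_pos
  have hb2 := sum_weight_re_le (fun c : Fin n × Bool × Fin d => punctured Γ c.1)
    (fun c => specNorm_punctured_le Γ c.1) u v (fun x c => ψ x c) (fun y c => -ψ y (flip c))
    one_pos
  simp only [h1, h2, inv_one, one_mul, mul_one] at hb1 hb2
  have key : ∑ x, ∑ y, Γ x y * (u x * v y) * (inner ℂ (ψ x) (ψ y)).re =
      ∑ x, ∑ y, Γ x y * (u x * v y) * (inner ℂ (oracle d x (ψ x)) (oracle d y (ψ y))).re +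
      (∑ x, ∑ y, u x * v y *
        ∑ c : Fin n × Bool × Fin d, punctured Γ c.1 x y * (starRingEnd ℂ (ψ x c) * ψ y c).re +
      ∑ x, ∑ y, u x * v y * ∑ c : Fin n × Bool × Fin d,
        punctured Γ c.1 x y * (starRingEnd ℂ (ψ x c) * -ψ y (flip c)).re) := by
    simp only [← Finset.sum_add_distrib]
    refine Finset.sum_congr rfl fun x _ => Finset.sum_congr rfl fun y _ => ?_
    rw [inner_oracle, inner_eq_sum_conj_mul, Complex.re_sum, Complex.re_sum]
    simp only [Finset.mul_sum, ← Finset.sum_add_distrib]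
    refine Finset.sum_congr rfl fun c _ => ?_
    simp only [punctured, Matrix.of_apply]
    by_cases hc : x c.1 = y c.1
    · simp only [hc, if_true]
      ring
    · have : flip c = (c.1, !c.2.1, c.2.2) := by simp [flip, oraclePerm]
      simp only [hc, if_false, this, mul_neg, Complex.neg_re]
      ring
  rw [key]
  linarith

/-- The progress measure is small once the inputs are distinguished. -/
theorem final_progress {n d : ℕ} {f : Input n → Bool}
    {Γ : Matrix (Input n) (Input n) ℝ} (hΓ : ∀ x y, f x = f y → Γ x y = 0)
    (ψ : Input n → QSpace n d) (hψ : ∀ x, ‖ψ x‖ = 1)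
    (hf : ∀ x, 2 / 3 ≤ ∑ i, ∑ w, ‖ψ x (i, f x, w)‖ ^ 2) (u v : Input n → ℝ) :
    ∑ x, ∑ y, Γ x y * (u x * v y) * (inner ℂ (ψ x) (ψ y)).re ≤
      17 / 18 * specNorm Γ * ((∑ x, u x ^ 2 + ∑ y, v y ^ 2) / 2) := by
  let a : Input n → Fin n × Fin d → ℂ := fun x c => ψ x (c.1, f x, c.2)
  let b : Input n → Fin n × Fin d → ℂ := fun x c => ψ x (c.1, !f x, c.2)
  have hsplit : ∀ (g : Fin n × Bool × Fin d → ℂ) (e : Bool),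
      ∑ c, g c = ∑ c : Fin n × Fin d, (g (c.1, e, c.2) + g (c.1, !e, c.2)) := by
    intro g e
    rw [Fintype.sum_prod_type, Fintype.sum_prod_type]
    refine Finset.sum_congr rfl fun i _ => ?_
    rw [Fintype.sum_prod_type, Fintype.sum_bool, Finset.sum_add_distrib]
    cases e
    · exact add_comm _ _
    · rfl
  have hab : ∀ x, ∑ c, ‖a x c‖ ^ 2 + ∑ c, ‖b x c‖ ^ 2 = 1 := by
    intro x
    have h := EuclideanSpace.norm_sq_eq (ψ x)
    rw [hψ, one_pow] at h
    have h2 := hsplit (fun c => ((‖ψ x c‖ ^ 2 : ℝ) : ℂ)) (f x)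
    rw [← Finset.sum_add_distrib, h]
    exact_mod_cast h2.symm
  have ha : ∀ x, 2 / 3 ≤ ∑ c, ‖a x c‖ ^ 2 := by
    intro x
    rw [Fintype.sum_prod_type]
    exact hf x
  -- The weight favours the correct output: `(3/4)p + (4/3)(1 - p) ≤ 17/18` for `p ≥ 2/3`. The
  -- unweighted bound would only give `1`.
  have hb1 := sum_weight_re_le (fun _ : Fin n × Fin d => Γ) (fun _ => le_rfl) u v a b
    (s := 3 / 4) (by norm_num)
  have hb2 := sum_weight_re_le (fun _ : Fin n × Fin d => Γ) (fun _ => le_rfl) u v b a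
    (s := (3 / 4)⁻¹) (by norm_num)
  -- If `f x ≠ f y`, the correct part `a` of one state overlaps only with the wrong part `b` of the
  -- other.
  have key : ∑ x, ∑ y, Γ x y * (u x * v y) * (inner ℂ (ψ x) (ψ y)).re =
      ∑ x, ∑ y, u x * v y * ∑ c, Γ x y * (starRingEnd ℂ (a x c) * b y c).re +
      ∑ x, ∑ y, u x * v y * ∑ c, Γ x y * (starRingEnd ℂ (b x c) * a y c).re := by
    simp only [← Finset.sum_add_distrib]
    refine Finset.sum_congr rfl fun x _ => Finset.sum_congr rfl fun y _ => ?_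
    by_cases hxy : f x = f y
    · simp [hΓ x y hxy]
    · have hy : f y = !f x := by
        cases hx : f x <;> cases hy : f y <;> simp_all
      rw [inner_eq_sum_conj_mul, hsplit _ (f x), Complex.re_sum]
      simp only [Finset.mul_sum, ← Finset.sum_add_distrib]
      refine Finset.sum_congr rfl fun c _ => ?_
      simp only [a, b, hy, Bool.not_not, Complex.add_re]
      ring
  have hw : ∀ u : Input n → ℝ, 3 / 4 * ∑ x, u x ^ 2 * ∑ c, ‖a x c‖ ^ 2 +
      (3 / 4)⁻¹ * ∑ x, u x ^ 2 * ∑ c, ‖b x c‖ ^ 2 ≤ 17 / 18 * ∑ x, u x ^ 2 := by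
    intro u
    rw [Finset.mul_sum, Finset.mul_sum, Finset.mul_sum, ← Finset.sum_add_distrib]
    refine Finset.sum_le_sum fun x _ => ?_
    have h1 := hab x
    have h2 := ha x
    have h3 : 3 / 4 * ∑ c, ‖a x c‖ ^ 2 + (3 / 4)⁻¹ * ∑ c, ‖b x c‖ ^ 2 ≤ 17 / 18 := by
      rw [← eq_sub_iff_add_eq'] at h1
      rw [h1]
      norm_num
      linarith
    have h4 := mul_le_mul_of_nonneg_left h3 (sq_nonneg (u x))
    linarith
  have hu := mul_le_mul_of_nonneg_left (hw u) (specNorm_nonneg Γ)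
  have hv := mul_le_mul_of_nonneg_left (hw v) (specNorm_nonneg Γ)
  rw [inv_inv] at hb2
  rw [key]
  linarith

theorem specNorm_le_of_computes {n T : ℕ} [NeZero n] {f : Input n → Bool} {A : Algorithm n T}
    (hA : A.Computes f) {Γ : Matrix (Input n) (Input n) ℝ} (hΓ : IsAdversaryMatrix f Γ) :
    specNorm Γ ≤ 36 * T * maxPuncturedNorm Γ := by
  have hN := maxPuncturedNorm_nonneg Γ
  have hS := specNorm_nonneg Γ
  -- Absorbing the first term leaves `‖Γ‖ / 18 ≤ 2T maxᵢ ‖Γᵢ‖`, whence the factor `36`.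
  have hle : specNorm Γ ≤ 17 / 18 * specNorm Γ + 2 * T * maxPuncturedNorm Γ := by
    refine specNorm_le_of_sum_le Γ (by positivity) fun u v => ?_
    have hstep : ∀ t : Fin (T + 1), ∑ x, ∑ y, Γ x y * (u x * v y) ≤
        ∑ x, ∑ y, Γ x y * (u x * v y) * (inner ℂ (A.state x t) (A.state y t)).re +
          t.val * (maxPuncturedNorm Γ * (∑ x, u x ^ 2 + ∑ y, v y ^ 2)) := by
      intro t
      induction t using Fin.induction with
      | zero =>
        refine le_of_eq ?_
        have : ∀ x, A.state x 0 = A.U 0 A.initState := fun x => rfl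
        simp [this, Algorithm.initState]
      | succ t ih =>
        refine ih.trans ?_
        have h := query_progress Γ (fun x => A.state x t.castSucc) (fun x => A.norm_state x _) u v
        have h1 : ∀ x, A.state x t.succ = A.U t.succ (oracle A.d x (A.state x t.castSucc)) := by
          intro x
          simp [Algorithm.state]
        simp only [h1, LinearIsometryEquiv.inner_map_map, Fin.val_succ, Fin.val_castSucc] at h ⊢
        push_cast
        linarith
    have h1 := hstep (Fin.last T)
    have h2 := final_progress hΓ.sparse (fun x => A.state x (Fin.last T))
      (fun x => A.norm_state x _) hA u v
    rw [Fin.val_last] at h1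
    linarith
  linarith

theorem adv_le_of_computes {n T : ℕ} [NeZero n] {f : Input n → Bool} {A : Algorithm n T}
    (hA : A.Computes f) : adv f ≤ 36 * T := by
  refine Real.sSup_le ?_ (by positivity)
  rintro r ⟨Γ, hΓ, -, rfl⟩
  exact div_le_of_le_mul₀ (maxPuncturedNorm_nonneg Γ) (by positivity)
    (specNorm_le_of_computes hA hΓ)

open scoped MatrixOrder Matrix.Norms.L2Operator

/-! ### Duality -/

/-- The entry `∑_{i : xᵢ ≠ yᵢ} Xᵢ[x, y]`. -/
def crossSum {n : ℕ} (X : Fin n → Matrix (Input n) (Input n) ℝ) (x y : Input n) : ℝ :=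
  ∑ i, if x i = y i then 0 else X i x y

theorem crossSum_add {n : ℕ} (X Y : Fin n → Matrix (Input n) (Input n) ℝ) (x y : Input n) :
    crossSum (X + Y) x y = crossSum X x y + crossSum Y x y := by
  rw [crossSum, crossSum, crossSum, ← Finset.sum_add_distrib]
  refine Finset.sum_congr rfl fun i _ => ?_
  split_ifs
  · simp
  · rfl

theorem crossSum_smul {n : ℕ} (c : ℝ) (X : Fin n → Matrix (Input n) (Input n) ℝ)
    (x y : Input n) : crossSum (c • X) x y = c * crossSum X x y := by
  rw [crossSum, crossSum, Finset.mul_sum]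
  refine Finset.sum_congr rfl fun i _ => ?_
  split_ifs
  · simp
  · rfl

/-- The strictly feasible right-hand sides of the dual program. -/
def dualCone {n : ℕ} (f : Input n → Bool) : Set ((Input n → Input n → ℝ) × (Input n → ℝ)) :=
  {q | ∃ X : Fin n → Matrix (Input n) (Input n) ℝ, (∀ i, (X i).PosSemidef) ∧
    (∀ x y, f x = false → f y = true → crossSum X x y = q.1 x y) ∧ ∀ x, ∑ i, X i x x < q.2 x}

theorem dualCone_add {n : ℕ} {f : Input n → Bool} {p q} (hp : p ∈ dualCone f)
    (hq : q ∈ dualCone f) : p + q ∈ dualCone f := by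
  obtain ⟨X, hX, hXc, hXd⟩ := hp
  obtain ⟨Y, hY, hYc, hYd⟩ := hq
  refine ⟨X + Y, fun i => (hX i).add (hY i), fun x y hx hy => ?_, fun x => ?_⟩
  · rw [crossSum_add, hXc x y hx hy, hYc x y hx hy]
    rfl
  · have : ∑ i, (X + Y) i x x = ∑ i, X i x x + ∑ i, Y i x x := by
      rw [← Finset.sum_add_distrib]
      rfl
    rw [this]
    exact add_lt_add (hXd x) (hYd x)

theorem dualCone_smul {n : ℕ} {f : Input n → Bool} {p} {c : ℝ} (hc : 0 < c)
    (hp : p ∈ dualCone f) : c • p ∈ dualCone f := by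
  obtain ⟨X, hX, hXc, hXd⟩ := hp
  refine ⟨c • X, fun i => (hX i).smul hc.le, fun x y hx hy => ?_, fun x => ?_⟩
  · rw [crossSum_smul, hXc x y hx hy]
    rfl
  · have : ∑ i, (c • X) i x x = c * ∑ i, X i x x := by
      rw [Finset.mul_sum]
      rfl
    rw [this]
    exact mul_lt_mul_of_pos_left (hXd x) hc

theorem convex_dualCone {n : ℕ} (f : Input n → Bool) : Convex ℝ (dualCone f) := by
  rw [convex_iff_forall_pos]
  intro p hp q hq a b ha hb _
  exact dualCone_add (dualCone_smul ha hp) (dualCone_smul hb hq)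

theorem posSemidef_rankOne {m : Type*} [Fintype m] (c : m → ℝ) :
    (Matrix.of fun x y => c x * c y : Matrix m m ℝ).PosSemidef := by
  have := Matrix.posSemidef_vecMulVec_self_star c
  simpa [Matrix.vecMulVec] using this

/-- Every right-hand side `E` is attained with diagonal at most `∑ |E|`. -/
theorem exists_crossSum_eq {n : ℕ} (f : Input n → Bool) (E : Input n → Input n → ℝ) :
    ∃ X : Fin n → Matrix (Input n) (Input n) ℝ, (∀ i, (X i).PosSemidef) ∧
      (∀ x y, f x = false → f y = true → crossSum X x y = E x y) ∧
      ∀ x, ∑ i, X i x x ≤ ∑ y, ∑ z, |E y z| := by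
  classical
  have hex : ∀ p : Input n × Input n, ∃ i : Option (Fin n),
      (f p.1 = false → f p.2 = true → ∃ j, i = some j ∧ p.1 j ≠ p.2 j) := by
    intro p
    by_cases hp : p.1 = p.2
    · exact ⟨none, fun h1 h2 => by rw [hp, h2] at h1; cases h1⟩
    · obtain ⟨j, hj⟩ := Function.ne_iff.1 hp
      exact ⟨some j, fun _ _ => ⟨j, rfl, hj⟩⟩
  choose idx hidx using hex
  -- On pairs with `f x = 0`, `f y = 1`, the matrix `c_p c_pᵀ` has the single entry `E p` at `p`; it
  -- goes to an index where the two strings of `p` differ.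
  let c : Input n × Input n → Input n → ℝ := fun p z =>
    if f z then (if z = p.2 then SignType.sign (E p.1 p.2) * √|E p.1 p.2| else 0)
      else (if z = p.1 then √|E p.1 p.2| else 0)
  let X : Fin n → Matrix (Input n) (Input n) ℝ := fun i =>
    ∑ p, if idx p = some i then Matrix.of fun x y => c p x * c p y else 0
  have hXapp : ∀ i x y, X i x y = ∑ p, if idx p = some i then c p x * c p y else 0 := by
    intro i x y
    simp only [X, Matrix.sum_apply]
    refine Finset.sum_congr rfl fun p _ => ?_
    split_ifs <;> rfl
  refine ⟨X, fun i => ?_, fun x y hx hy => ?_, fun x => ?_⟩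
  · refine Matrix.posSemidef_sum _ fun p _ => ?_
    split_ifs
    · exact posSemidef_rankOne (c p)
    · exact Matrix.PosSemidef.zero
  · obtain ⟨j, hj, hxy⟩ := hidx (x, y) hx hy
    have hc : ∀ p, c p x * c p y = if p = (x, y) then E x y else 0 := by
      rintro ⟨x', y'⟩
      simp only [c, hx, hy, if_true, Bool.false_eq_true, if_false, Prod.mk.injEq]
      by_cases h1 : x = x'
      · by_cases h2 : y = y'
        · subst h1 h2
          simp only [if_true, and_self]
          rw [mul_left_comm, Real.mul_self_sqrt (abs_nonneg _), sign_mul_abs]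
        · simp [h2, Ne.symm h2]
      · simp [h1, Ne.symm h1]
    simp only [crossSum, hXapp, hc]
    rw [Finset.sum_eq_single j]
    · rw [if_neg hxy, Finset.sum_eq_single (x, y)]
      · simp [hj]
      · intro p _ hp
        simp [hp]
      · simp
    · intro i _ hi
      rw [Finset.sum_eq_single (x, y)]
      · simp [hj, Ne.symm hi]
      · intro p _ hp
        simp [hp]
      · simp
    · simp
  · have hc : ∀ p : Input n × Input n, c p x * c p x ≤ |E p.1 p.2| := by
      intro p
      have h0 := Real.mul_self_sqrt (abs_nonneg (E p.1 p.2))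
      simp only [c]
      split_ifs
      · rcases lt_trichotomy (E p.1 p.2) 0 with h | h | h
        · rw [sign_neg h]
          simp only [SignType.coe_neg_one]
          linarith
        · simp [h]
        · rw [sign_pos h]
          simp only [SignType.coe_one]
          linarith
      · simp
      · linarith
      · simp
    simp only [hXapp]
    rw [Finset.sum_comm, ← Fintype.sum_prod_type' fun y z => |E y z|]
    refine Finset.sum_le_sum fun p _ => le_trans ?_ (hc p)
    cases hp : idx p with
    | none => simpa using mul_self_nonneg (c p x)
    | some j => simp

theorem isOpen_dualCone {n : ℕ} (f : Input n → Bool) : IsOpen (dualCone f) := by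
  rw [isOpen_iff_mem_nhds]
  rintro ⟨M, t⟩ ⟨X, hX, hXc, hXd⟩
  -- A perturbation of the off-diagonal data costs at most its `ℓ¹` norm on the diagonal, and the
  -- strict inequality leaves room for it.
  have hopen : IsOpen {q : (Input n → Input n → ℝ) × (Input n → ℝ) |
      ∀ x, ∑ i, X i x x + ∑ y, ∑ z, |q.1 y z - M y z| < q.2 x} := by
    simp only [Set.ofPred_forall]
    refine isOpen_iInter_of_finite fun x => isOpen_lt ?_ ?_ <;> fun_prop
  refine Filter.mem_of_superset (hopen.mem_nhds (by simpa using hXd)) ?_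
  rintro ⟨M', t'⟩ h
  obtain ⟨Y, hY, hYc, hYd⟩ := exists_crossSum_eq f fun y z => M' y z - M y z
  refine ⟨X + Y, fun i => (hX i).add (hY i), fun x y hx hy => ?_, fun x => ?_⟩
  · rw [crossSum_add, hXc x y hx hy, hYc x y hx hy]
    simp
  · have : ∑ i, (X + Y) i x x = ∑ i, X i x x + ∑ i, Y i x x := by
      rw [← Finset.sum_add_distrib]
      rfl
    rw [this]
    exact (add_le_add_right (hYd x) _).trans_lt (h x)

/-- Multipliers certifying that the value `V` is infeasible. -/
theorem exists_multipliers {n : ℕ} {f : Input n → Bool} {V : ℝ}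
    (hV : ((fun _ _ => 1, fun _ => V) : (Input n → Input n → ℝ) × (Input n → ℝ)) ∉ dualCone f) :
    ∃ (Γ : Input n → Input n → ℝ) (μ : Input n → ℝ),
      (∀ (X : Fin n → Matrix (Input n) (Input n) ℝ) (M : Input n → Input n → ℝ) (t : Input n → ℝ),
        (∀ i, (X i).PosSemidef) →
        (∀ x y, f x = false → f y = true → crossSum X x y = M x y) →
        (∀ x, ∑ i, X i x x ≤ t x) → ∑ x, ∑ y, Γ x y * M x y ≤ ∑ x, μ x * t x) ∧
      V * ∑ x, μ x ≤ ∑ x, ∑ y, Γ x y ∧ ¬(Γ = 0 ∧ μ = 0) := by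
  classical
  obtain ⟨g, hg⟩ := geometric_hahn_banach_open_point (convex_dualCone f) (isOpen_dualCone f) hV
  set p : (Input n → Input n → ℝ) × (Input n → ℝ) := (fun _ _ => 1, fun _ => V) with hp
  let Γ : Input n → Input n → ℝ := fun x y => g (Pi.single x (Pi.single y 1), 0)
  let μ : Input n → ℝ := fun x => -g (0, Pi.single x 1)
  have hgapp : ∀ M t, g (M, t) = ∑ x, ∑ y, Γ x y * M x y - ∑ x, μ x * t x := by
    intro M t
    have h1 : (M, t) = ∑ x, ∑ y, M x y • ((Pi.single x (Pi.single y 1), 0) :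
        (Input n → Input n → ℝ) × (Input n → ℝ)) +
        ∑ x, t x • ((0, Pi.single x 1) : (Input n → Input n → ℝ) × (Input n → ℝ)) := by
      refine Prod.ext ?_ ?_
      · simp only [Prod.fst_add, Prod.fst_sum, Prod.smul_fst, smul_zero, Finset.sum_const_zero,
          add_zero]
        ext x y
        simp [Finset.sum_apply, Pi.single_apply, ite_apply]
      · simp only [Prod.snd_add, Prod.snd_sum, Prod.smul_snd, smul_zero, Finset.sum_const_zero,
          zero_add]
        ext x
        simp [Finset.sum_apply, Pi.single_apply]
    rw [h1, map_add, map_sum, map_sum]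
    simp only [map_sum, map_smul, smul_eq_mul, Γ, μ, neg_mul, Finset.sum_neg_distrib,
      sub_neg_eq_add]
    simp only [mul_comm]
  have hmem : ((0, fun _ => 1) : (Input n → Input n → ℝ) × (Input n → ℝ)) ∈ dualCone f :=
    ⟨0, fun i => Matrix.PosSemidef.zero, fun x y _ _ => by simp [crossSum], fun x => by simp⟩
  -- A functional bounded above on a cone is nonpositive there.
  have hnonpos : ∀ a ∈ dualCone f, g a ≤ 0 := by
    intro a ha
    by_contra! h
    have h1 := hg _ (dualCone_smul (show 0 < (|g p| + 1) / g a by positivity) ha)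
    rw [map_smul, smul_eq_mul, div_mul_cancel₀ _ h.ne'] at h1
    linarith [le_abs_self (g p)]
  have hp0 : 0 ≤ g p := by
    by_contra! h
    have h0 := (hg _ hmem).trans h
    have h1 := hg _ (dualCone_smul (div_pos_of_neg_of_neg h h0) hmem)
    rw [map_smul, smul_eq_mul, div_mul_cancel₀ _ h0.ne] at h1
    exact lt_irrefl _ h1
  refine ⟨Γ, μ, fun X M t hX hXc hXd => ?_, ?_, ?_⟩
  · have h1 : ∀ ε : ℝ, 0 < ε → g (M, t) + ε * g (0, fun _ => 1) ≤ 0 := by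
      intro ε hε
      have h2 := hnonpos ((M, t) + ε • (0, fun _ => 1))
        ⟨X, hX, fun x y hx hy => by simpa using hXc x y hx hy,
          fun x => by simpa using (hXd x).trans_lt (lt_add_of_pos_right _ hε)⟩
      rwa [map_add, map_smul, smul_eq_mul] at h2
    have h3 : g (M, t) ≤ 0 := by
      by_contra! h
      have h4 := h1 (g (M, t) / (2 * (|g (0, fun _ => 1)| + 1))) (by positivity)
      have h5 : g (M, t) / (2 * (|g (0, fun _ => 1)| + 1)) * (-(|g (0, fun _ => 1)| + 1)) ≤
          g (M, t) / (2 * (|g (0, fun _ => 1)| + 1)) * g (0, fun _ => 1) :=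
        mul_le_mul_of_nonneg_left (by linarith [neg_abs_le (g (0, fun _ => 1))]) (by positivity)
      have h6 : g (M, t) / (2 * (|g (0, fun _ => 1)| + 1)) * (-(|g (0, fun _ => 1)| + 1)) =
          -(g (M, t) / 2) := by
        field_simp
      linarith
    rw [hgapp] at h3
    linarith
  · rw [hp, hgapp] at hp0
    simp only [mul_one, ← Finset.sum_mul] at hp0
    linarith
  · rintro ⟨h1, h2⟩
    have h3 := hg _ hmem
    rw [hp, hgapp, hgapp, h1, h2] at h3
    simp at h3

/-- An adversary matrix from multipliers. -/
theorem le_adv_of_not_mem_dualCone {n : ℕ} [NeZero n] {f : Input n → Bool} {V : ℝ} (hV0 : 0 < V)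
    (hV : ((fun _ _ => 1, fun _ => V) : (Input n → Input n → ℝ) × (Input n → ℝ)) ∉ dualCone f) :
    V ≤ adv f := by
  classical
  obtain ⟨Γ, μ, hdual, hval, hne⟩ := exists_multipliers hV
  have hμ : ∀ x, 0 ≤ μ x := by
    intro x
    have h := hdual 0 0 (Pi.single x 1) (fun i => Matrix.PosSemidef.zero)
      (fun x y _ _ => by simp [crossSum]) (fun z => by
        simpa using (Pi.single_nonneg.2 zero_le_one : (0 : Input n → ℝ) ≤ Pi.single x 1) z)
    simpa [Pi.single_apply] using h
  -- Outside pairs with `f x = 0`, `f y = 1` the data `M` are unconstrained, so their multiplier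
  -- vanishes.
  have hsparse : ∀ x y, ¬(f x = false ∧ f y = true) → Γ x y = 0 := by
    intro x y hxy
    have h : ∀ r : ℝ, Γ x y * r ≤ 0 := by
      intro r
      have h := hdual 0 (Pi.single x (Pi.single y r)) 0 (fun i => Matrix.PosSemidef.zero)
        (fun x' y' hx' hy' => by
          have : ¬(x' = x ∧ y' = y) := by
            rintro ⟨rfl, rfl⟩
            exact hxy ⟨hx', hy'⟩
          by_cases h1 : x' = x
          · subst h1
            have h2 : y' ≠ y := fun h => this ⟨rfl, h⟩
            simp [crossSum, h2]
          · simp [crossSum, h1]) (fun z => by simp)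
      simpa [Pi.single_apply, ite_apply] using h
    linarith [h 1, h (-1)]
  have hquad : ∀ (i : Fin n) (c : Input n → ℝ),
      ∑ x, ∑ y, Γ x y * (if x i = y i then 0 else c x * c y) ≤ ∑ x, μ x * c x ^ 2 := by
    intro i c
    refine hdual (Pi.single i (Matrix.of fun x y => c x * c y)) _ _ (fun j => ?_)
      (fun x y _ _ => ?_) (fun x => ?_)
    · by_cases hj : j = i
      · subst hj
        simpa using posSemidef_rankOne c
      · rw [Pi.single_eq_of_ne hj]
        exact Matrix.PosSemidef.zero
    · rw [crossSum, Finset.sum_eq_single i]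
      · simp
      · intro j _ hj
        simp [hj]
      · simp
    · rw [Finset.sum_eq_single i]
      · simp [pow_two]
      · intro j _ hj
        simp [hj]
      · simp
  set H : Matrix (Input n) (Input n) ℝ := Matrix.of fun x y => Γ x y + Γ y x with hH
  have hbil : ∀ (i : Fin n) (a b : Input n → ℝ),
      ∑ x, ∑ y, punctured H i x y * (a x * b y) ≤ ∑ x, μ x * (a x ^ 2 + b x ^ 2) := by
    -- `Γ` couples zeros of `f` to ones of `f`, so gluing `a` and `b` along `f` turns the quadratic
    -- bound into a bilinear one; the swapped gluing handles the transpose.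
    intro i a b
    have h1 := hquad i fun z => if f z then b z else a z
    have h2 := hquad i fun z => if f z then a z else b z
    have e1 : ∑ x, ∑ y, punctured H i x y * (a x * b y) =
        ∑ x, ∑ y, Γ x y * (if x i = y i then 0 else a x * b y) +
        ∑ x, ∑ y, Γ x y * (if x i = y i then 0 else b x * a y) := by
      rw [Finset.sum_comm (f := fun x y => Γ x y * (if x i = y i then 0 else b x * a y))]
      simp only [← Finset.sum_add_distrib]
      refine Finset.sum_congr rfl fun x _ => Finset.sum_congr rfl fun y _ => ?_
      simp only [punctured, hH, Matrix.of_apply, eq_comm (a := y i)]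
      split_ifs <;> ring
    have e2 : ∀ a b : Input n → ℝ, ∑ x, ∑ y, Γ x y * (if x i = y i then 0 else a x * b y) =
        ∑ x, ∑ y, Γ x y * (if x i = y i then 0 else
          (if f x then b x else a x) * (if f y then b y else a y)) := by
      intro a b
      refine Finset.sum_congr rfl fun x _ => Finset.sum_congr rfl fun y _ => ?_
      by_cases hxy : f x = false ∧ f y = true
      · simp [hxy]
      · simp [hsparse x y hxy]
    rw [e1, e2 a b, e2 b a]
    refine (add_le_add h1 h2).trans (le_of_eq ?_)
    rw [← Finset.sum_add_distrib]
    refine Finset.sum_congr rfl fun x _ => ?_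
    split_ifs <;> ring
  have hHsymm : ∀ x y, H x y = H y x := fun x y => add_comm _ _
  have hHsparse : ∀ x y, f x = f y → H x y = 0 := by
    intro x y hxy
    simp only [hH, Matrix.of_apply]
    rw [hsparse x y (by rw [hxy]; simp), hsparse y x (by rw [hxy]; simp), add_zero]
  -- Where `μ x = 0`, scaling the test vector at `x` is free, so a nonzero entry would violate the
  -- bilinear bound.
  have hHzero : ∀ x y, μ x = 0 → H x y = 0 := by
    intro x y hx
    by_cases hxy : x = y
    · exact hHsparse x y (by rw [hxy])
    obtain ⟨i, hi⟩ := Function.ne_iff.1 hxy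
    have h : ∀ r : ℝ, H x y * r ≤ μ y := by
      intro r
      have h := hbil i (Pi.single x r) (Pi.single y 1)
      have e1 : ∑ x', ∑ y', punctured H i x' y' *
          ((Pi.single x r : Input n → ℝ) x' * (Pi.single y 1 : Input n → ℝ) y') = H x y * r := by
        rw [Finset.sum_eq_single x, Finset.sum_eq_single y]
        · simp [punctured, hi]
        · intro y' _ hy'
          simp [hy']
        · simp
        · intro x' _ hx'
          simp [hx']
        · simp
      have e2 : ∑ z, μ z * ((Pi.single x r : Input n → ℝ) z ^ 2 +
          (Pi.single y 1 : Input n → ℝ) z ^ 2) = μ y := by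
        rw [Finset.sum_eq_single y]
        · simp [Ne.symm hxy]
        · intro z _ hz
          by_cases hzx : z = x
          · rw [hzx, hx, zero_mul]
          · simp [hz, hzx]
        · simp
      rwa [e1, e2] at h
    by_contra hne
    have h1 := h ((μ y + 1) / H x y)
    rw [mul_div_cancel₀ _ hne] at h1
    linarith
  have hμpos : 0 < ∑ x, μ x := by
    refine (Finset.sum_nonneg fun x _ => hμ x).lt_of_ne fun h => hne ?_
    have hμ0 : ∀ x, μ x = 0 := fun x =>
      (Finset.sum_eq_zero_iff_of_nonneg fun x _ => hμ x).1 h.symm x (Finset.mem_univ x)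
    refine ⟨?_, funext hμ0⟩
    ext x y
    by_cases hxy : f x = false ∧ f y = true
    · have h1 := hHzero x y (hμ0 x)
      simp only [hH, Matrix.of_apply] at h1
      rwa [hsparse y x (by rw [hxy.1, hxy.2]; simp), add_zero] at h1
    · exact hsparse x y hxy
  -- Rescaling by `μ^(-1/2)` turns the weighted bounds into spectral norm bounds. Where `μ` vanishes
  -- the inverse is `0`, harmless since `H` vanishes there too.
  set G : Matrix (Input n) (Input n) ℝ :=
    Matrix.of fun x y => H x y * ((√(μ x))⁻¹ * (√(μ y))⁻¹) with hG
  have hGadv : IsAdversaryMatrix f G := by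
    refine ⟨fun x y => ?_, fun x y hxy => ?_⟩
    · simp only [hG, Matrix.of_apply]
      rw [hHsymm x y, mul_comm (√(μ x))⁻¹]
    · simp only [hG, Matrix.of_apply]
      rw [hHsparse x y hxy, zero_mul]
  have hGpunct : maxPuncturedNorm G ≤ 2 := by
    refine Finset.sup'_le _ _ fun i _ => specNorm_le_of_sum_le _ zero_le_two fun a b => ?_
    have h := hbil i (fun x => a x * (√(μ x))⁻¹) (fun x => b x * (√(μ x))⁻¹)
    have e1 : ∑ x, ∑ y, punctured G i x y * (a x * b y) =
        ∑ x, ∑ y, punctured H i x y * (a x * (√(μ x))⁻¹ * (b y * (√(μ y))⁻¹)) := by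
      refine Finset.sum_congr rfl fun x _ => Finset.sum_congr rfl fun y _ => ?_
      simp only [punctured, hG, Matrix.of_apply]
      split_ifs <;> ring
    rw [e1]
    refine h.trans ?_
    rw [mul_div_cancel₀ _ two_ne_zero, ← Finset.sum_add_distrib]
    refine Finset.sum_le_sum fun x _ => ?_
    rcases (hμ x).eq_or_lt with h0 | h0
    · rw [← h0, zero_mul]
      positivity
    · rw [mul_pow, mul_pow, inv_pow, Real.sq_sqrt h0.le]
      refine le_of_eq ?_
      field_simp
  -- The test vector `√μ` has squared norm `∑ μ`, and its form is `2 ∑ Γ ≥ 2V ∑ μ`.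
  have hGnorm : 2 * V ≤ specNorm G := by
    have h := sum_mul_mul_le_specNorm G (fun x => √(μ x)) (fun x => √(μ x)) one_pos
    have e1 : ∑ x, ∑ y, G x y * (√(μ x) * √(μ y)) = 2 * ∑ x, ∑ y, Γ x y := by
      have e2 : ∀ x y, G x y * (√(μ x) * √(μ y)) = H x y := by
        intro x y
        simp only [hG, Matrix.of_apply]
        rcases (hμ x).eq_or_lt with h0 | h0
        · rw [hHzero x y h0.symm]
          ring
        rcases (hμ y).eq_or_lt with h1 | h1
        · rw [hHsymm, hHzero y x h1.symm]
          ring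
        have := Real.sqrt_pos.2 h0
        have := Real.sqrt_pos.2 h1
        field_simp
      simp only [e2, hH, Matrix.of_apply, Finset.sum_add_distrib]
      rw [Finset.sum_comm (f := fun x y => Γ y x)]
      ring
    rw [e1] at h
    simp only [Real.sq_sqrt (hμ _)] at h
    have h2 : 2 * V * ∑ x, μ x ≤ specNorm G * ∑ x, μ x := by
      norm_num at h
      linarith
    exact le_of_mul_le_mul_right h2 hμpos
  have hGne : G ≠ 0 := by
    intro h
    rw [h] at hGnorm
    have : specNorm (0 : Matrix (Input n) (Input n) ℝ) = 0 := by simp [specNorm]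
    linarith
  have hpunct_pos : 0 < maxPuncturedNorm G := by
    by_contra! h
    refine hGne ?_
    ext x y
    by_cases hxy : x = y
    · exact hGadv.sparse x y (by rw [hxy])
    obtain ⟨i, hi⟩ := Function.ne_iff.1 hxy
    have h1 := ((abs_apply_le_specNorm (punctured G i) x y).trans
      (specNorm_punctured_le G i)).trans h
    simpa [punctured, hi] using h1
  refine le_trans ?_ (le_csSup (bddAbove_adversaryRatios f) ⟨G, hGadv, hGne, rfl⟩)
  rw [le_div_iff₀ hpunct_pos]
  nlinarith

/-! ### Realizations as Gram vectors of feasible points -/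

/-- Vector realizations from feasible points of the dual program. -/
theorem exists_realization_of_mem_dualCone {n : ℕ} {f : Input n → Bool} {V : ℝ}
    (hV : ((fun _ _ => 1, fun _ => V) : (Input n → Input n → ℝ) × (Input n → ℝ)) ∈ dualCone f) :
    ∃ (d : ℕ) (w : Input n → Fin n → EuclideanSpace ℂ (Fin d)),
      IsVectorRealization f w ∧ realizationValue w ≤ V := by
  classical
  obtain ⟨X, hX, hXc, hXd⟩ := hV
  have hB : ∀ i, ∃ B : Matrix (Input n) (Input n) ℝ, X i = B.conjTranspose * B := fun i =>
    CStarAlgebra.nonneg_iff_eq_star_mul_self.1 (hX i).nonneg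
  choose B hB using hB
  let e := Fintype.equivFin (Input n)
  let w : Input n → Fin n → EuclideanSpace ℂ (Fin (Fintype.card (Input n))) := fun x i =>
    WithLp.toLp 2 fun k => (B i (e.symm k) x : ℂ)
  have hinner : ∀ x y i, inner ℂ (w x i) (w y i) = ((X i x y : ℝ) : ℂ) := by
    intro x y i
    rw [inner_eq_sum_conj_mul, hB i, Matrix.mul_apply, ← e.sum_comp]
    push_cast
    refine Finset.sum_congr rfl fun z _ => ?_
    simp [w]
  have hcross : ∀ x y, ∑ i ∈ Finset.univ.filter (fun i => x i ≠ y i), inner ℂ (w x i) (w y i) =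
      ((crossSum X x y : ℝ) : ℂ) := by
    intro x y
    simp only [hinner, crossSum, Finset.sum_filter]
    push_cast
    refine Finset.sum_congr rfl fun i _ => ?_
    by_cases h : x i = y i <;> simp [h]
  have hsymm : ∀ x y, crossSum X x y = crossSum X y x := by
    intro x y
    refine Finset.sum_congr rfl fun i _ => ?_
    have : X i x y = X i y x := by simpa using ((hX i).isHermitian.apply x y).symm
    rw [this]
    simp only [eq_comm]
  refine ⟨_, w, fun x y hxy => ?_, Finset.sup'_le _ _ fun x _ => ?_⟩
  · rw [hcross]
    cases hx : f x <;> cases hy : f y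
    · exact absurd (hx.trans hy.symm) hxy
    · rw [hXc x y hx hy]
      simp
    · rw [hsymm, hXc y x hy hx]
      simp
    · exact absurd (hx.trans hy.symm) hxy
  · refine le_trans (le_of_eq ?_) (hXd x).le
    refine Finset.sum_congr rfl fun i _ => ?_
    have h := hinner x x i
    rw [inner_self_eq_norm_sq_to_K] at h
    have h2 : ((‖w x i‖ : ℝ) : ℂ) ^ 2 = ((X i x x : ℝ) : ℂ) := h
    exact_mod_cast h2

theorem exists_realization_le {n : ℕ} [NeZero n] (f : Input n → Bool) :
    ∃ (d : ℕ) (w : Input n → Fin n → EuclideanSpace ℂ (Fin d)),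
      IsVectorRealization f w ∧ realizationValue w ≤ 2 * adv f := by
  by_cases hconst : ∀ x y, f x = f y
  · refine ⟨0, 0, fun x y hxy => absurd (hconst x y) hxy, ?_⟩
    have h0 : 0 ≤ adv f := Real.sSup_nonneg (by
      rintro r ⟨Γ, -, -, rfl⟩
      exact div_nonneg (specNorm_nonneg _) (maxPuncturedNorm_nonneg _))
    refine Finset.sup'_le _ _ fun x _ => ?_
    simpa using h0
  push Not at hconst
  obtain ⟨x₀, y₀, hxy⟩ := hconst
  have h0 : 0 ≤ adv f := Real.sSup_nonneg (by
    rintro r ⟨Γ, -, -, rfl⟩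
    exact div_nonneg (specNorm_nonneg _) (maxPuncturedNorm_nonneg _))
  have hreal : ∀ V, adv f < V → ∃ (d : ℕ) (w : Input n → Fin n → EuclideanSpace ℂ (Fin d)),
      IsVectorRealization f w ∧ realizationValue w ≤ V := by
    intro V hV
    refine exists_realization_of_mem_dualCone (by_contra fun h => ?_)
    exact absurd (le_adv_of_not_mem_dualCone (h0.trans_lt hV) h) (not_le.2 hV)
  -- Every value above `adv f` is attained and is at least `1`. Hence `adv f < 2 * adv f`, which
  -- avoids a compactness argument at the optimum.
  have h1 : 1 ≤ adv f := by
    refine le_of_forall_pos_le_add fun ε hε => ?_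
    obtain ⟨d, w, hw, hle⟩ := hreal (adv f + ε) (by linarith)
    exact (one_le_realizationValue hw hxy).trans hle
  exact hreal _ (by linarith)

end QuantumQuery

theorem mainTheorem2 :
    -- any vector realization yields a quantum algorithm
    (∃ C : ℝ, 0 < C ∧
      ∀ (n : ℕ) [NeZero n] (f : QuantumQuery.Input n → Bool) (d : ℕ)
        (w : QuantumQuery.Input n → Fin n → EuclideanSpace ℂ (Fin d)),
        QuantumQuery.IsVectorRealization f w →
          ∃ (T : ℕ) (A : QuantumQuery.Algorithm n T),
            A.Computes f ∧ (T : ℝ) ≤ C * QuantumQuery.realizationValue w) ∧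
    -- some vector realization has value of the order of the adversary value
    (∃ a b : ℝ, 0 < a ∧ a ≤ b ∧
      ∀ (n : ℕ) [NeZero n] (f : QuantumQuery.Input n → Bool),
        ∃ (d : ℕ) (w : QuantumQuery.Input n → Fin n → EuclideanSpace ℂ (Fin d)),
          QuantumQuery.IsVectorRealization f w ∧
          a * QuantumQuery.adv f ≤ QuantumQuery.realizationValue w ∧
          QuantumQuery.realizationValue w ≤ b * QuantumQuery.adv f) ∧
    -- the adversary value characterizes the quantum query complexity
    (∃ c₁ c₂ : ℝ, 0 < c₁ ∧ c₁ < c₂ ∧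
      ∀ (n : ℕ) [NeZero n] (f : QuantumQuery.Input n → Bool),
        (∃ A : QuantumQuery.Algorithm n (QuantumQuery.queryComplexity f), A.Computes f) ∧
        c₁ * QuantumQuery.adv f ≤ (QuantumQuery.queryComplexity f : ℝ) ∧
        (QuantumQuery.queryComplexity f : ℝ) ≤ c₂ * QuantumQuery.adv f) := by
  -- Here `180 = 36 · 5` combines `adv ≤ 36T` with `T ≤ 5V`, and `10 = 5 · 2` combines `T ≤ 5V` with
  -- `V ≤ 2 adv`.
  refine ⟨⟨5, by norm_num, fun n _ f d w hw => QuantumQuery.exists_algorithm_of_realization hw⟩,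
    ⟨180⁻¹, 2, by norm_num, by norm_num, fun n _ f => ?_⟩,
    ⟨36⁻¹, 10, by norm_num, by norm_num, fun n _ f => ?_⟩⟩
  · obtain ⟨d, w, hw, hle⟩ := QuantumQuery.exists_realization_le f
    obtain ⟨T, A, hA, hT⟩ := QuantumQuery.exists_algorithm_of_realization hw
    have := QuantumQuery.adv_le_of_computes hA
    exact ⟨d, w, hw, by linarith, hle⟩
  · obtain ⟨d, w, hw, hle⟩ := QuantumQuery.exists_realization_le f
    obtain ⟨T, A, hA, hT⟩ := QuantumQuery.exists_algorithm_of_realization hw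
    have hmem : ∃ A : QuantumQuery.Algorithm n (QuantumQuery.queryComplexity f), A.Computes f :=
      Nat.sInf_mem (s := {T : ℕ | ∃ A : QuantumQuery.Algorithm n T, A.Computes f}) ⟨T, A, hA⟩
    have hmin : QuantumQuery.queryComplexity f ≤ T := Nat.sInf_le ⟨A, hA⟩
    have hmin' : (QuantumQuery.queryComplexity f : ℝ) ≤ T := Nat.cast_le.2 hmin
    obtain ⟨A', hA'⟩ := hmem
    have := QuantumQuery.adv_le_of_computes hA'
    exact ⟨⟨A', hA'⟩, by linarith, by linarith⟩

end
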